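/- Let $T\ge 1$, let $a_1,\dots,a_T>0$ and $b_1,\dots,b_T\in\mathbb{R}$, and for $(\epsilon,\eta)\in\mathbb{R}^2$ let $J_{\epsilon,\eta}$ be the bounded operator on $\ell^2(\mathbb{N};\mathbb{C})$ given by the half-line tridiagonal $T$-periodic Jacobi matrix whose diagonal is the periodic repetition of $(b_1+\epsilon,b_2,\dots,b_T)$ and whose two off-diagonals are the periodic repetition of $(a_1+\eta,a_2,\dots,a_T)$; that is, writing $(a_n')$ and $(b_n')$ for these two $T$-periodic sequences, $(J_{\epsilon,\eta}u)_1=b_1'u_1+a_1'u_2$ and $(J_{\epsilon,\eta}u)_n=a_{n-1}'u_{n-1}+b_n'u_n+a_n'u_{n+1}$ for $n\ge 2$. Then there exists an open dense set $D\subset\mathbb{R}^2$ such that for all $(\epsilon,\eta)\in D$ the essential spectrum $\sigma_{ess}(J_{\epsilon,\eta})=\{z\in\mathbb{C}: J_{\epsilon,\eta}-z \text{ is not Fredholm}\}$ consists of $T$ distinct real intervals, i.e. there are real numbers $\alpha_1<\beta_1<\alpha_2<\beta_2<\dots<\alpha_T<\beta_T$ with $\sigma_{ess}(J_{\epsilon,\eta})=\bigcup_{i=1}^{T}[\alpha_i,\beta_i]$.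 -/

import Mathlib

open scoped ENNReal

/-- The Hilbert space `ℓ²(ℕ; ℂ)`. -/
abbrev EllTwo : Type := lp (fun _ : ℕ => ℂ) 2

/-- The formal action `u ↦ (a_{n-1} u_{n-1} + b_n u_n + a_n u_{n+1})_n` of the half-line Jacobi matrix
with diagonal `b` and off-diagonal `a`; in the row `n = 0` the first term is absent. -/
def jacobiAction (a b : ℕ → ℝ) (u : ℕ → ℂ) : ℕ → ℂ
  | 0 => (b 0 : ℂ) * u 0 + (a 0 : ℂ) * u 1
  | n + 1 => (a n : ℂ) * u n + (b (n + 1) : ℂ) * u (n + 1) + (a (n + 1) : ℂ) * u (n + 2)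

theorem jacobiAction_add (a b : ℕ → ℝ) (u v : ℕ → ℂ) :
    jacobiAction a b (u + v) = jacobiAction a b u + jacobiAction a b v := by
  funext n
  cases n <;> simp only [jacobiAction, Pi.add_apply] <;> ring

theorem jacobiAction_smul (a b : ℕ → ℝ) (c : ℂ) (u : ℕ → ℂ) :
    jacobiAction a b (c • u) = c • jacobiAction a b u := by
  funext n
  cases n <;> simp only [jacobiAction, Pi.smul_apply, smul_eq_mul] <;> ring

theorem memlp_two_iff (u : ℕ → ℂ) :
    Memℓp (E := fun _ : ℕ => ℂ) u 2 ↔ Summable fun n => ‖u n‖ ^ 2 := by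
  rw [memℓp_gen_iff (by norm_num)]
  simp

theorem memlp_bounded_mul {c : ℕ → ℝ} {C : ℝ} (hc : ∀ n, |c n| ≤ C) {u : ℕ → ℂ}
    (hu : Memℓp (E := fun _ : ℕ => ℂ) u 2) :
    Memℓp (E := fun _ : ℕ => ℂ) (fun n => (c n : ℂ) * u n) 2 := by
  refine Memℓp.mono' (F := fun _ : ℕ => ℂ) (g := fun n => (C : ℂ) * u n) (hu.const_mul (C : ℂ)) ?_
  intro n
  rw [norm_mul, norm_mul, Complex.norm_real, Complex.norm_real]
  exact mul_le_mul_of_nonneg_right ((hc n).trans (le_abs_self C)) (norm_nonneg _)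

/-- A Jacobi matrix with bounded entries maps square summable sequences to such sequences. -/
theorem memlp_jacobiAction {a b : ℕ → ℝ} {C : ℝ} (ha : ∀ n, |a n| ≤ C) (hb : ∀ n, |b n| ≤ C)
    {u : ℕ → ℂ} (hu : Memℓp (E := fun _ : ℕ => ℂ) u 2) :
    Memℓp (E := fun _ : ℕ => ℂ) (jacobiAction a b u) 2 := by
  have h1 : Memℓp (E := fun _ : ℕ => ℂ) (fun n => (b n : ℂ) * u n) 2 := memlp_bounded_mul hb hu
  have h2 : Memℓp (E := fun _ : ℕ => ℂ) (fun n => (a n : ℂ) * u (n + 1)) 2 := by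
    refine memlp_bounded_mul (u := fun n => u (n + 1)) ha ?_
    rw [memlp_two_iff] at hu ⊢
    exact (summable_nat_add_iff (f := fun n => ‖u n‖ ^ 2) 1).2 hu
  have h3 : Memℓp (E := fun _ : ℕ => ℂ)
      (fun n : ℕ => Nat.casesOn n (0 : ℂ) fun k => (a k : ℂ) * u k) 2 := by
    have h := memlp_bounded_mul ha hu
    rw [memlp_two_iff] at h ⊢
    exact (summable_nat_add_iff 1).1 h
  have h := (h3.add h1).add h2
  refine cast (congrArg (fun f => Memℓp (E := fun _ : ℕ => ℂ) f 2) ?_) h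
  funext n
  cases n with
  | zero => simp [jacobiAction]
  | succ k => simp [jacobiAction]

/-- The entry of index `n` of the `T`-periodic sequence with period `c 0, …, c (T - 1)`. -/
def periodicExt {T : ℕ} [NeZero T] (c : Fin T → ℝ) (n : ℕ) : ℝ := c (Fin.ofNat T n)

theorem abs_periodicExt_le {T : ℕ} [NeZero T] (c : Fin T → ℝ) (n : ℕ) :
    |periodicExt c n| ≤ ‖c‖ := norm_le_pi_norm c _

/-- The `T`-periodic Jacobi operator as a linear map of `ℓ²(ℕ; ℂ)`. -/
noncomputable def periodicJacobiₗ {T : ℕ} [NeZero T] (a b : Fin T → ℝ) : EllTwo →ₗ[ℂ] EllTwo where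
  toFun u := ⟨jacobiAction (periodicExt a) (periodicExt b) u,
    memlp_jacobiAction (C := max ‖a‖ ‖b‖)
      (fun n => (abs_periodicExt_le a n).trans (le_max_left _ _))
      (fun n => (abs_periodicExt_le b n).trans (le_max_right _ _)) (lp.memℓp u)⟩
  map_add' _ _ := Subtype.ext (jacobiAction_add _ _ _ _)
  map_smul' _ _ := Subtype.ext (jacobiAction_smul _ _ _ _)

theorem continuous_periodicJacobiₗ {T : ℕ} [NeZero T] (a b : Fin T → ℝ) :
    Continuous (periodicJacobiₗ a b) := by
  have ev : ∀ n : ℕ, Continuous fun u : EllTwo => (u : ℕ → ℂ) n := fun n =>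
    (lp.evalCLM ℂ (fun _ : ℕ => ℂ) 2 n).continuous
  refine (periodicJacobiₗ a b).continuous_of_seq_closed_graph ?_
  intro u x y hu hy
  ext n
  refine tendsto_nhds_unique (((ev n).tendsto y).comp hy) ?_
  have h : Continuous fun v : EllTwo => (periodicJacobiₗ a b v : ℕ → ℂ) n := by
    cases n with
    | zero =>
      exact (continuous_const.mul (ev 0)).add (continuous_const.mul (ev 1))
    | succ k =>
      exact ((continuous_const.mul (ev k)).add (continuous_const.mul (ev (k + 1)))).add
        (continuous_const.mul (ev (k + 2)))
  exact (h.tendsto x).comp hu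

/-- The half-line `T`-periodic Jacobi operator on `ℓ²(ℕ; ℂ)`, with off-diagonal entries `a` and
diagonal entries `b` repeated periodically. The indices `0, …, T - 1` stand for `1, …, T`. -/
noncomputable def periodicJacobi {T : ℕ} [NeZero T] (a b : Fin T → ℝ) : EllTwo →L[ℂ] EllTwo :=
  ⟨periodicJacobiₗ a b, continuous_periodicJacobiₗ a b⟩

theorem periodicJacobi_apply {T : ℕ} [NeZero T] (a b : Fin T → ℝ) (u : EllTwo) :
    (periodicJacobi a b u : ℕ → ℂ) = jacobiAction (periodicExt a) (periodicExt b) u := rfl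

/-- The operator `J_{ε,η}`: in each period the first diagonal entry is shifted by `ε` and the first
off-diagonal entry by `η`. -/
noncomputable def perturbedJacobi {T : ℕ} [NeZero T] (a b : Fin T → ℝ) (ε η : ℝ) :
    EllTwo →L[ℂ] EllTwo :=
  periodicJacobi (Function.update a 0 (a 0 + η)) (Function.update b 0 (b 0 + ε))

/-- The essential spectrum of a bounded operator: the `z` for which `A - z` is not Fredholm. -/
def essentialSpectrum {H : Type*} [NormedAddCommGroup H] [NormedSpace ℂ H] (A : H →L[ℂ] H) :
    Set ℂ :=
  {z | ¬ (A - z • ContinuousLinearMap.id ℂ H).IsFredholm}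

/-- `S ⊆ ℂ` is the union of `T` pairwise disjoint nondegenerate compact intervals of the real line,
listed from left to right. -/
def IsUnionOfDistinctIntervals (T : ℕ) (S : Set ℂ) : Prop :=
  ∃ α β : Fin T → ℝ, (∀ i, α i < β i) ∧ (∀ i j, i < j → β i < α j) ∧
    S = (fun x : ℝ => (x : ℂ)) '' ⋃ i, Set.Icc (α i) (β i)

/-!
Write `J` for a half-line periodic Jacobi operator with period `T` and nonzero off-diagonal entries
`α`, write `c` and `s` for the solutions of the three-term recurrence with
`(c_0, c_1) = (1, 0)` and `(s_0, s_1) = (0, 1)`, and `Δ = c_T + s_{T+1}` for the discriminant, the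
trace of the monodromy matrix, whose determinant is `1`.

*The essential spectrum is `{z | Δ z ∈ [-2, 2]}`* (`essentialSpectrum_periodicJacobi`). If `Δ z` is
not in `[-2, 2]`, the monodromy matrix has eigenvalues `l`, `1 / l` with `|l| > 1`. By
Cayley–Hamilton, `(L - l) (L - 1 / l) u` is bounded by `(J - z) u`, where `L` is the left shift by
`T` places, and so `J - z` is bounded below on the sequences that vanish on the first two periods.
The orthogonal complement of the image of these is finite dimensional, since its elements solve a
recurrence. Hence `J - z` is Fredholm. If `Δ z` is in `[-2, 2]`, there is a Floquet solution of
periodic modulus; its truncations `u` have unbounded norm while `(J - z) u` stays bounded, and the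
kernel of `J - z` is too small for that to happen with a Fredholm operator.

*Counting bands* (`isUnionOfDistinctIntervals_jacobiDiscr`). The polynomial `s_T` has `T - 1` simple
real zeros, which interlace with those of `s_{T-1}`. At such a zero the monodromy matrix is
triangular, with diagonal entries `κ / α_0` and `α_0 / κ`, where `κ = -α_{T-1} s_{T-1}` alternates
in sign from zero to zero. If `κ ^ 2 ≠ α_0 ^ 2` at all of them, then `|Δ| > 2` there with alternating
signs. Since `Δ` has degree `T`, it takes each value in `[-2, 2]` exactly once between neighbouring
zeros of `s_T` (and once beyond either end), and nowhere else in `ℂ`. This yields `T` separated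
bands.

*Genericity.* The polynomial `s_T`, its zeros and the numbers `κ` do not depend on the entries
`α_0` and `β_0`, which are those that the parameters `η` and `ε` shift. So it is enough to keep
`α_0` away from `0` and from the finitely many numbers `±κ`.
-/

/-! ### The three-term recurrence -/

/-- The solution `u` of `α n u_n + β (n+1) u_{n+1} + α (n+1) u_{n+2} = z u_{n+1}` with `u_0 = p` and
`u_1 = q`, in a commutative real algebra: real polynomials (with `z = X`), `ℝ` and `ℂ` are all
needed. -/
noncomputable def jacobiSol {A : Type*} [CommRing A] [Algebra ℝ A] (α β : ℕ → ℝ) (z p q : A) : ℕ → A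
  | 0 => p
  | 1 => q
  | n + 2 => (α (n + 1))⁻¹ • ((z - algebraMap ℝ A (β (n + 1))) * jacobiSol α β z p q (n + 1)
      - α n • jacobiSol α β z p q n)

/-- `u` satisfies all rows but the first one of the eigenvalue equation of the Jacobi matrix. -/
def IsJacobiSol {A : Type*} [CommRing A] [Algebra ℝ A] (α β : ℕ → ℝ) (z : A) (u : ℕ → A) : Prop :=
  ∀ n, α (n + 1) • u (n + 2) = (z - algebraMap ℝ A (β (n + 1))) * u (n + 1) - α n • u n

section Recurrence

variable {A B : Type*} [CommRing A] [Algebra ℝ A] [CommRing B] [Algebra ℝ B]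

theorem jacobiSol_add_two (α β : ℕ → ℝ) (z p q : A) (n : ℕ) :
    jacobiSol α β z p q (n + 2) = (α (n + 1))⁻¹ • ((z - algebraMap ℝ A (β (n + 1))) *
      jacobiSol α β z p q (n + 1) - α n • jacobiSol α β z p q n) := by
  rw [jacobiSol]

theorem isJacobiSol_jacobiSol {α : ℕ → ℝ} (hα : ∀ n, α n ≠ 0) (β : ℕ → ℝ) (z p q : A) :
    IsJacobiSol α β z (jacobiSol α β z p q) := by
  intro n
  rw [jacobiSol_add_two, smul_smul, mul_inv_cancel₀ (hα _), one_smul]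

theorem map_jacobiSol (f : A →ₐ[ℝ] B) (α β : ℕ → ℝ) (z p q : A) (n : ℕ) :
    f (jacobiSol α β z p q n) = jacobiSol α β (f z) (f p) (f q) n := by
  induction n using Nat.twoStepInduction with
  | zero => rfl
  | one => rfl
  | more n h1 h2 => simp [jacobiSol_add_two, h1, h2]

/-- The value of a solution at the site `n` involves only the entries of index less than `n`, and
`α 0` only if `p ≠ 0`. -/
theorem jacobiSol_congr {α α' β β' : ℕ → ℝ} (z q : A) {N : ℕ}
    (hα : ∀ n, 0 < n → n < N → α n = α' n) (hβ : ∀ n, 0 < n → n < N → β n = β' n)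
    {n : ℕ} (hn : n ≤ N) : jacobiSol α β z 0 q n = jacobiSol α' β' z 0 q n := by
  induction n using Nat.twoStepInduction with
  | zero => rfl
  | one => rfl
  | more n h1 h2 =>
    rw [jacobiSol_add_two, jacobiSol_add_two, h1 (by omega), h2 (by omega),
      hα (n + 1) (by omega) (by omega), hβ (n + 1) (by omega) (by omega)]
    rcases n with _ | n
    · simp [jacobiSol]
    · rw [hα (n + 1) (by omega) (by omega)]

theorem IsJacobiSol.eq_of_eq {α β : ℕ → ℝ} (hα : ∀ n, α n ≠ 0) {z : A} {u v : ℕ → A}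
    (hu : IsJacobiSol α β z u) (hv : IsJacobiSol α β z v) (h0 : u 0 = v 0) (h1 : u 1 = v 1)
    (n : ℕ) : u n = v n := by
  induction n using Nat.twoStepInduction with
  | zero => exact h0
  | one => exact h1
  | more n i1 i2 =>
    have h := hu n
    rw [i1, i2, ← hv n] at h
    have := congrArg ((α (n + 1))⁻¹ • ·) h
    simpa [smul_smul, inv_mul_cancel₀ (hα (n + 1))] using this

theorem IsJacobiSol.comb {α β : ℕ → ℝ} {z : A} {u v : ℕ → A}
    (hu : IsJacobiSol α β z u) (hv : IsJacobiSol α β z v) (p q : A) :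
    IsJacobiSol α β z (fun n => p * u n + q * v n) := by
  intro n
  have h1 := hu n
  have h2 := hv n
  simp only [Algebra.smul_def] at h1 h2 ⊢
  linear_combination p * h1 + q * h2

theorem IsJacobiSol.shift {α β : ℕ → ℝ} {z : A} {u : ℕ → A} (hu : IsJacobiSol α β z u) {T : ℕ}
    (hα : ∀ n, α (n + T) = α n) (hβ : ∀ n, β (n + T) = β n) :
    IsJacobiSol α β z (fun n => u (n + T)) := by
  intro n
  have h := hu (n + T)
  rw [show n + T + 1 = n + 1 + T by ring, show n + T + 2 = n + 2 + T by ring, hα, hα, hβ] at h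
  exact h

/-- Every solution is a combination of the two fundamental ones. -/
theorem IsJacobiSol.eq_comb {α β : ℕ → ℝ} (hα : ∀ n, α n ≠ 0) {z : A} {u : ℕ → A}
    (hu : IsJacobiSol α β z u) (n : ℕ) :
    u n = u 0 * jacobiSol α β z 1 0 n + u 1 * jacobiSol α β z 0 1 n :=
  hu.eq_of_eq hα ((isJacobiSol_jacobiSol hα β z 1 0).comb (isJacobiSol_jacobiSol hα β z 0 1) _ _)
    (by simp [jacobiSol]) (by simp [jacobiSol]) n

/-- Constancy of the Wronskian of the two fundamental solutions. -/
theorem jacobiSol_wronskian {α : ℕ → ℝ} (hα : ∀ n, α n ≠ 0) (β : ℕ → ℝ) (z : A) (n : ℕ) :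
    α n • (jacobiSol α β z 1 0 n * jacobiSol α β z 0 1 (n + 1)
      - jacobiSol α β z 1 0 (n + 1) * jacobiSol α β z 0 1 n) = algebraMap ℝ A (α 0) := by
  induction n with
  | zero => simp [jacobiSol, Algebra.smul_def]
  | succ n ih =>
    rw [← ih]
    have h1 := isJacobiSol_jacobiSol hα β z (1 : A) 0 n
    have h2 := isJacobiSol_jacobiSol hα β z (0 : A) 1 n
    simp only [Algebra.smul_def] at h1 h2 ⊢
    linear_combination jacobiSol α β z 1 0 (n + 1) * h2 - jacobiSol α β z 0 1 (n + 1) * h1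

/-- The discriminant of a `T`-periodic Jacobi matrix: the trace of the monodromy matrix, which maps
`(u_0, u_1)` to `(u_T, u_{T+1})` for each solution `u`. -/
noncomputable def jacobiDiscr (T : ℕ) (α β : ℕ → ℝ) (z : A) : A :=
  jacobiSol α β z 1 0 T + jacobiSol α β z 0 1 (T + 1)

theorem map_jacobiDiscr (f : A →ₐ[ℝ] B) (T : ℕ) (α β : ℕ → ℝ) (z : A) :
    f (jacobiDiscr T α β z) = jacobiDiscr T α β (f z) := by
  simp [jacobiDiscr, map_jacobiSol]

/-- The monodromy matrix has determinant one. -/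
theorem jacobiSol_monodromy_det {α : ℕ → ℝ} (hα : ∀ n, α n ≠ 0) (β : ℕ → ℝ) (z : A) {T : ℕ}
    (hT : α T = α 0) :
    jacobiSol α β z 1 0 T * jacobiSol α β z 0 1 (T + 1)
      - jacobiSol α β z 1 0 (T + 1) * jacobiSol α β z 0 1 T = 1 := by
  have h := congrArg ((α 0)⁻¹ • ·) (jacobiSol_wronskian hα β z T)
  simpa [hT, smul_smul, inv_mul_cancel₀ (hα 0), Algebra.algebraMap_eq_smul_one] using h

/-- The Cayley–Hamilton identity of the monodromy matrix, applied to a solution. -/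
theorem IsJacobiSol.cayleyHamilton {α β : ℕ → ℝ} (hα : ∀ n, α n ≠ 0) {z : A} {u : ℕ → A}
    (hu : IsJacobiSol α β z u) {T : ℕ} (hαT : ∀ n, α (n + T) = α n) (hβT : ∀ n, β (n + T) = β n)
    (n : ℕ) : u (n + T + T) - jacobiDiscr T α β z * u (n + T) + u n = 0 := by
  have hdet := jacobiSol_monodromy_det hα β z (T := T) (by simpa using hαT 0)
  have e1 := (hu.shift hαT hβT).eq_comb hα
  have e2 := ((hu.shift hαT hβT).shift hαT hβT).eq_comb hα
  simp only [zero_add] at e1 e2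
  have a0 := hu.eq_comb hα T
  have a1 := hu.eq_comb hα (1 + T)
  have b0 := e1 T
  have b1 := e1 (1 + T)
  rw [e2 n, e1 n, hu.eq_comb hα n, b0, b1, a0, a1,
    add_comm 1 T, jacobiDiscr]
  generalize jacobiSol α β z 1 0 n = c
  generalize jacobiSol α β z 0 1 n = s
  linear_combination (-(u 0 * c) - u 1 * s) * hdet
end Recurrence

/-! ### Polynomials with alternating values -/

section Alternating

open Polynomial Filter

theorem Polynomial.natDegree_X_sub_C_mul_sub {S R : ℝ[X]} {n : ℕ} (hS : S.natDegree = n)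
    (hS0 : S ≠ 0) (hR : R.natDegree ≤ n) (b : ℝ) :
    ((X - C b) * S - R).natDegree = n + 1 ∧
      ((X - C b) * S - R).leadingCoeff = S.leadingCoeff := by
  have h1 : ((X - C b) * S).natDegree = n + 1 := by
    rw [natDegree_mul (X_sub_C_ne_zero b) hS0, natDegree_X_sub_C, hS, add_comm]
  have h2 : R.natDegree < ((X - C b) * S).natDegree := by omega
  refine ⟨by rw [natDegree_sub_eq_left_of_natDegree_lt h2, h1], ?_⟩
  rw [leadingCoeff_sub_of_degree_lt (degree_lt_degree h2), leadingCoeff_mul,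
    leadingCoeff_X_sub_C, one_mul]

/-- Points at which `P` alternates can be supplemented by one point on either side, since the
behaviour of `P` at `±∞` fits into the pattern. -/
theorem Polynomial.exists_alternating_extension {P : ℝ[X]} {n : ℕ} (hdeg : P.natDegree = n + 1)
    (hlead : 0 < P.leadingCoeff) {K : ℝ} {x : ℕ → ℝ} (hx : ∀ i j, i < j → j < n → x i < x j)
    (hP : ∀ j < n, K < (-1) ^ (n + j) * P.eval (x j)) :
    ∃ y : ℕ → ℝ, (∀ i j, i < j → j < n + 2 → y i < y j) ∧
      (∀ j < n + 2, K < (-1) ^ (n + 1 + j) * P.eval (y j)) ∧ ∀ j < n, y (j + 1) = x j := by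
  have hdeg' : 0 < P.degree := natDegree_pos_iff_degree_pos.1 (by omega)
  obtain ⟨lo, hlo, hlox⟩ : ∃ lo, K < (-1) ^ (n + 1) * P.eval lo ∧ ∀ j < n, lo < x j := by
    set Q : ℝ[X] := C ((-1) ^ (n + 1)) * P.comp (-X) with hQ
    have hne : ((-1 : ℝ) ^ (n + 1)) ≠ 0 := by positivity
    have hQd : Q.natDegree = n + 1 := by
      rw [hQ, natDegree_C_mul hne, natDegree_comp, natDegree_neg, natDegree_X, hdeg, mul_one]
    have hQl : Q.leadingCoeff = P.leadingCoeff := by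
      rw [hQ, leadingCoeff_mul, leadingCoeff_C, leadingCoeff_comp (by simp), leadingCoeff_neg,
        leadingCoeff_X, hdeg, mul_left_comm, ← mul_pow]
      simp
    have h := (Q.tendsto_atTop_of_leadingCoeff_nonneg
      (natDegree_pos_iff_degree_pos.1 (by omega)) (by rw [hQl]; exact hlead.le)).eventually_gt_atTop K
    have h2 : ∀ᶠ y in atTop, ∀ j ∈ Finset.range n, -x j < y :=
      (Finset.eventually_all _).2 fun j _ => eventually_gt_atTop _
    obtain ⟨y, hy1, hy2⟩ := (h.and h2).exists
    refine ⟨-y, by simpa [hQ] using hy1, fun j hj => ?_⟩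
    have := hy2 j (Finset.mem_range.2 hj)
    linarith
  obtain ⟨hi, hhi, hhix, hlohi⟩ : ∃ hi, K < P.eval hi ∧ (∀ j < n, x j < hi) ∧ lo < hi := by
    have h := (P.tendsto_atTop_of_leadingCoeff_nonneg hdeg' hlead.le).eventually_gt_atTop K
    have h2 : ∀ᶠ y in atTop, ∀ j ∈ Finset.range n, x j < y :=
      (Finset.eventually_all _).2 fun j _ => eventually_gt_atTop _
    obtain ⟨y, hy1, hy2, hy3⟩ := (h.and (h2.and (eventually_gt_atTop lo))).exists
    exact ⟨y, hy1, fun j hj => hy2 j (Finset.mem_range.2 hj), hy3⟩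
  refine ⟨fun k => if k = 0 then lo else if k ≤ n then x (k - 1) else hi, ?_, ?_, ?_⟩
  · intro i j hij hj
    by_cases hi0 : i = 0 <;> by_cases hjn : j ≤ n
    · simpa [hi0, hjn, show j ≠ 0 by omega] using hlox _ (by omega)
    · simpa [hi0, hjn, show j ≠ 0 by omega] using hlohi
    · simpa [hi0, hjn, show j ≠ 0 by omega, show i ≤ n by omega] using
        hx (i - 1) (j - 1) (by omega) (by omega)
    · simpa [hi0, hjn, show j ≠ 0 by omega, show i ≤ n by omega] using
        hhix (i - 1) (by omega)
  · intro j hj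
    rcases j with _ | j
    · simpa using hlo
    · by_cases hjn : j + 1 ≤ n
      · have := hP j (by omega)
        simp only [Nat.add_eq_zero_iff, one_ne_zero, and_false, if_false, hjn, if_true,
          Nat.add_sub_cancel]
        rw [show n + 1 + (j + 1) = n + j + 2 by ring, pow_add]
        simpa using this
      · have : j = n := by omega
        subst this
        simp only [Nat.add_eq_zero_iff, one_ne_zero, and_false, if_false, hjn]
        rw [Even.neg_one_pow ⟨j + 1, rfl⟩, one_mul]
        exact hhi
  · intro j hj
    simp [show j + 1 ≤ n by omega]

theorem exists_mem_Ioo_eq_of_alternating {f : ℝ → ℝ} (hf : Continuous f) {K c p q : ℝ} {k : ℕ}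
    (hpq : p < q) (hc : |c| ≤ K) (hp : K < (-1) ^ k * f p) (hq : K < (-1) ^ (k + 1) * f q) :
    ∃ r ∈ Set.Ioo p q, f r = c := by
  have hc := abs_le.1 hc
  rcases neg_one_pow_eq_or ℝ k with h | h <;> rw [pow_succ] at hq <;> rw [h] at hp hq
  · exact intermediate_value_Ioo' hpq.le hf.continuousOn ⟨by linarith, by linarith⟩
  · exact intermediate_value_Ioo hpq.le hf.continuousOn ⟨by linarith, by linarith⟩

/-- If `f` passes from below `-K` to above `K` and takes each of the values `±K` only once, then the
set where `|f| ≤ K` is an interval. -/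
theorem exists_band_of_increasing {f : ℝ → ℝ} (hf : Continuous f) {K p q : ℝ} (hK : 0 < K)
    (hpq : p < q) (hp : f p < -K) (hq : K < f q)
    (huniq : ∀ c, |c| ≤ K → ∀ x ∈ Set.Ioo p q, ∀ y ∈ Set.Ioo p q, f x = c → f y = c → x = y) :
    ∃ α β, p < α ∧ α < β ∧ β < q ∧ ∀ x ∈ Set.Ioo p q, |f x| ≤ K ↔ x ∈ Set.Icc α β := by
  have ivt := fun (c s t : ℝ) (hst : s ≤ t) (h : c ∈ Set.Icc (f s) (f t)) =>
    intermediate_value_Icc hst hf.continuousOn h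
  have hKK : |K| ≤ K := (abs_of_pos hK).le
  have hKK' : |-K| ≤ K := by rw [abs_neg]; exact hKK
  obtain ⟨α, ⟨hα1, hα2⟩, hα⟩ : ∃ r ∈ Set.Ioo p q, f r = -K :=
    intermediate_value_Ioo hpq.le hf.continuousOn ⟨hp, by linarith⟩
  obtain ⟨β, ⟨hβ1, hβ2⟩, hβ⟩ : ∃ r ∈ Set.Ioo p q, f r = K :=
    intermediate_value_Ioo hpq.le hf.continuousOn ⟨by linarith, hq⟩
  -- Each violation produces, by the intermediate value theorem, a second point of value `±K`.
  have hαβ : α < β := by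
    by_contra! h
    obtain ⟨y, ⟨hy1, hy2⟩, hy⟩ := ivt (-K) p β hβ1.le ⟨hp.le, by linarith⟩
    have hy1' : p < y := lt_of_le_of_ne hy1 fun e => by rw [← e] at hy; linarith
    have := huniq _ hKK' y ⟨hy1', by linarith⟩ α ⟨hα1, hα2⟩ hy hα
    have : β = α := le_antisymm h (by linarith)
    rw [this] at hβ
    linarith
  refine ⟨α, β, hα1, hαβ, hβ2, fun x ⟨hx1, hx2⟩ => ⟨fun h => ?_, fun ⟨h1, h2⟩ => ?_⟩⟩
  · obtain ⟨h1, h2⟩ := abs_le.1 h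
    refine ⟨?_, ?_⟩
    · by_contra! hlt
      obtain ⟨y, ⟨hy1, hy2⟩, hy⟩ := ivt (-K) p x hx1.le ⟨hp.le, h1⟩
      have hy1' : p < y := lt_of_le_of_ne hy1 fun e => by rw [← e] at hy; linarith
      have := huniq _ hKK' y ⟨hy1', by linarith⟩ α ⟨hα1, hα2⟩ hy hα
      linarith
    · by_contra! hlt
      obtain ⟨y, ⟨hy1, hy2⟩, hy⟩ := ivt K x q hx2.le ⟨h2, hq.le⟩
      have hy2' : y < q := lt_of_le_of_ne hy2 fun e => by rw [e] at hy; linarith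
      have := huniq _ hKK y ⟨by linarith, hy2'⟩ β ⟨hβ1, hβ2⟩ hy hβ
      linarith
  · rw [abs_le]
    constructor
    · by_contra! hlt
      obtain ⟨y, ⟨hy1, hy2⟩, hy⟩ := ivt (-K) x β h2 ⟨hlt.le, by linarith⟩
      have := huniq _ hKK' y ⟨by linarith, by linarith⟩ α ⟨hα1, hα2⟩ hy hα
      have : x = α := le_antisymm (by linarith) h1
      rw [this] at hlt
      linarith
    · by_contra! hlt
      obtain ⟨y, ⟨hy1, hy2⟩, hy⟩ := ivt K α x h1 ⟨by linarith, hlt.le⟩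
      have := huniq _ hKK y ⟨by linarith, by linarith⟩ β ⟨hβ1, hβ2⟩ hy hβ
      have : x = β := le_antisymm h2 (by linarith)
      rw [this] at hlt
      linarith

theorem exists_band_of_alternating {f : ℝ → ℝ} (hf : Continuous f) {K p q : ℝ} {k : ℕ} (hK : 0 < K)
    (hpq : p < q) (hp : K < (-1) ^ k * f p) (hq : K < (-1) ^ (k + 1) * f q)
    (huniq : ∀ c, |c| ≤ K → ∀ x ∈ Set.Ioo p q, ∀ y ∈ Set.Ioo p q, f x = c → f y = c → x = y) :
    ∃ α β, p < α ∧ α < β ∧ β < q ∧ ∀ x ∈ Set.Ioo p q, |f x| ≤ K ↔ x ∈ Set.Icc α β := by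
  rcases neg_one_pow_eq_or ℝ k with h | h <;> rw [pow_succ] at hq <;> rw [h] at hp hq
  · have := exists_band_of_increasing (f := fun x => -f x) hf.neg hK hpq (by linarith) (by linarith)
      (fun c hc x hx y hy h1 h2 => huniq (-c) (by rwa [abs_neg]) x hx y hy (by linarith)
        (by linarith))
    simpa using this
  · exact exists_band_of_increasing hf hK hpq (by linarith) (by linarith) huniq

/-- A polynomial of degree `n` takes a value at no other complex points than `n` given ones. -/
theorem Polynomial.exists_eq_of_aeval_eq {P : ℝ[X]} {n : ℕ} (hdeg : P.natDegree = n) (hn : 0 < n)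
    {r : ℕ → ℝ} (hr : ∀ i j, i < j → j < n → r i < r j) {c : ℝ} (hc : ∀ j < n, P.eval (r j) = c)
    {z : ℂ} (hz : aeval z P = (c : ℂ)) : ∃ j < n, z = r j := by
  by_contra! hne
  set Q : ℂ[X] := (P - C c).map (algebraMap ℝ ℂ) with hQ
  have hQd : Q.natDegree = n := by rw [hQ, natDegree_map, natDegree_sub_C, hdeg]
  have hQ0 : Q ≠ 0 := by
    intro h
    rw [h, natDegree_zero] at hQd
    omega
  have hinj : Set.InjOn (fun j => (r j : ℂ)) (Finset.range n : Set ℕ) := by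
    intro i hi j hj hij
    have hi' : i < n := by simpa using hi
    have hj' : j < n := by simpa using hj
    have hij' : r i = r j := by simpa using hij
    rcases lt_trichotomy i j with h | h | h
    · exact absurd hij' (hr i j h hj').ne
    · exact h
    · exact absurd hij' (hr j i h hi').ne'
  have hz' : z ∉ (Finset.range n).image fun j => (r j : ℂ) := by
    intro h
    obtain ⟨j, hj, e⟩ := Finset.mem_image.1 h
    exact hne j (Finset.mem_range.1 hj) e.symm
  have hsub : (insert z ((Finset.range n).image fun j => (r j : ℂ))).val ⊆ Q.roots := by
    intro w hw
    rw [mem_roots hQ0, IsRoot.def, hQ, eval_map_algebraMap]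
    rw [Finset.mem_val] at hw
    rcases Finset.mem_insert.1 hw with rfl | hw
    · simp [hz]
    · obtain ⟨j, hj, rfl⟩ := Finset.mem_image.1 hw
      have := hc j (Finset.mem_range.1 hj)
      rw [map_sub, aeval_C, ← Complex.coe_algebraMap, aeval_algebraMap_apply]
      simp [this]
  have := card_le_degree_of_subset_roots hsub
  rw [Finset.card_insert_of_notMem hz', Finset.card_image_of_injOn hinj, Finset.card_range, hQd]
    at this
  omega

/-- The sign of a polynomial with `n = deg Q` known real zeros, `j` of them below the point `y`. -/
theorem Polynomial.neg_one_pow_mul_eval_pos {Q : ℝ[X]} {n j : ℕ} (hdeg : Q.natDegree = n)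
    (hlead : 0 < Q.leadingCoeff) {x : ℕ → ℝ} (hx : ∀ i j, i < j → j < n → x i < x j)
    (hzero : ∀ i < n, Q.eval (x i) = 0) (hj : j ≤ n) {y : ℝ} (hlow : ∀ i < j, x i < y)
    (hhigh : ∀ i, j ≤ i → i < n → y < x i) : 0 < (-1) ^ (n + j) * Q.eval y := by
  have hQ0 : Q ≠ 0 := leadingCoeff_ne_zero.1 hlead.ne'
  have hinj : Set.InjOn x (Finset.range n : Set ℕ) := by
    intro i hi j hj hij
    have hi' : i < n := by simpa using hi
    have hj' : j < n := by simpa using hj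
    rcases lt_trichotomy i j with h | h | h
    · exact absurd hij (hx i j h hj').ne
    · exact h
    · exact absurd hij (hx j i h hi').ne'
  have hle : ((Finset.range n).image x).val ≤ Q.roots := by
    refine (Multiset.le_iff_subset (Finset.nodup _)).2 fun w hw => ?_
    rw [Finset.mem_val] at hw
    obtain ⟨i, hi, rfl⟩ := Finset.mem_image.1 hw
    exact (mem_roots hQ0).2 (hzero i (Finset.mem_range.1 hi))
  have hcard : ((Finset.range n).image x).val.card = n := by
    rw [Finset.card_val, Finset.card_image_of_injOn hinj, Finset.card_range]
  have hroots : ((Finset.range n).image x).val = Q.roots :=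
    Multiset.eq_of_le_of_card_le hle (by rw [hcard, ← hdeg]; exact card_roots' Q)
  have hprod : Q = C Q.leadingCoeff * ∏ i ∈ Finset.range n, (X - C (x i)) := by
    conv_lhs => rw [← C_leadingCoeff_mul_prod_multiset_X_sub_C
      (p := Q) (by rw [← hroots, hcard, hdeg]), ← hroots]
    congr 1
    change ∏ a ∈ (Finset.range n).image x, (X - C a) = _
    exact Finset.prod_image hinj
  have heval : Q.eval y = Q.leadingCoeff * ∏ i ∈ Finset.range n, (y - x i) := by
    conv_lhs => rw [hprod]
    simp [eval_prod]
  obtain ⟨k, rfl⟩ := Nat.exists_eq_add_of_le hj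
  have h2 : ∏ i ∈ Finset.range k, (y - x (j + i))
      = (-1) ^ k * ∏ i ∈ Finset.range k, (x (j + i) - y) := by
    rw [← Finset.card_range k, ← Finset.prod_const, Finset.card_range, ← Finset.prod_mul_distrib]
    exact Finset.prod_congr rfl fun i _ => by ring
  have p1 : 0 < ∏ i ∈ Finset.range j, (y - x i) :=
    Finset.prod_pos fun i hi => sub_pos.2 (hlow i (Finset.mem_range.1 hi))
  have p2 : 0 < ∏ i ∈ Finset.range k, (x (j + i) - y) :=
    Finset.prod_pos fun i hi => sub_pos.2
      (hhigh _ (by omega) (by have := Finset.mem_range.1 hi; omega))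
  have hs : (-1 : ℝ) ^ (j + k + j) * (-1) ^ k = 1 := by
    rw [← pow_add]
    exact Even.neg_one_pow ⟨j + k, by ring⟩
  rw [heval, Finset.prod_range_add, h2]
  calc (0 : ℝ) < Q.leadingCoeff * (∏ i ∈ Finset.range j, (y - x i)) *
        ∏ i ∈ Finset.range k, (x (j + i) - y) := by positivity
    _ = _ := by linear_combination (-(Q.leadingCoeff * (∏ i ∈ Finset.range j, (y - x i)) *
        ∏ i ∈ Finset.range k, (x (j + i) - y))) * hs

/-- A polynomial of degree `n + 1` which takes values larger than `K` in modulus and of alternating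
signs at `n` points has `n + 1` bands: each value in `[-K, K]` is taken once between any two
neighbouring points (`±∞` included), hence nowhere else in the complex plane. -/
theorem Polynomial.isUnionOfDistinctIntervals_of_alternating {P : ℝ[X]} {n : ℕ}
    (hdeg : P.natDegree = n + 1) (hlead : 0 < P.leadingCoeff) {K : ℝ} (hK : 0 < K) {x : ℕ → ℝ}
    (hx : ∀ i j, i < j → j < n → x i < x j)
    (hP : ∀ j < n, K < (-1) ^ (n + j) * P.eval (x j)) :
    IsUnionOfDistinctIntervals (n + 1) {z : ℂ | ∃ c : ℝ, |c| ≤ K ∧ aeval z P = (c : ℂ)} := by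
  obtain ⟨y, hy, hPy, -⟩ := exists_alternating_extension hdeg hlead hx hP
  have hymono : ∀ i j, i ≤ j → j < n + 2 → y i ≤ y j := fun i j hij hj => by
    rcases hij.eq_or_lt with rfl | h
    · exact le_rfl
    · exact (hy i j h hj).le
  have key : ∀ c : ℝ, |c| ≤ K → ∃ r : ℕ → ℝ,
      (∀ j < n + 1, r j ∈ Set.Ioo (y j) (y (j + 1)) ∧ P.eval (r j) = c) ∧
      ∀ z : ℂ, aeval z P = (c : ℂ) → ∃ j < n + 1, z = r j := by
    intro c hc
    have : ∀ j, ∃ r, j < n + 1 → r ∈ Set.Ioo (y j) (y (j + 1)) ∧ P.eval r = c := by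
      intro j
      by_cases hj : j < n + 1
      · obtain ⟨r, h1, h2⟩ := exists_mem_Ioo_eq_of_alternating P.continuous
          (hy j (j + 1) (by omega) (by omega)) hc (hPy j (by omega)) (hPy (j + 1) (by omega))
        exact ⟨r, fun _ => ⟨h1, h2⟩⟩
      · exact ⟨0, fun h => absurd h hj⟩
    choose r hr using this
    refine ⟨r, hr, fun z hz => exists_eq_of_aeval_eq hdeg (by omega) ?_ (fun j hj => (hr j hj).2) hz⟩
    intro i j hij hj
    exact ((hr i (by omega)).1.2.trans_le (hymono (i + 1) j (by omega) (by omega))).trans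
      (hr j hj).1.1
  have huniq : ∀ j < n + 1, ∀ c, |c| ≤ K → ∀ s ∈ Set.Ioo (y j) (y (j + 1)),
      ∀ t ∈ Set.Ioo (y j) (y (j + 1)), P.eval s = c → P.eval t = c → s = t := by
    intro j hj c hc
    obtain ⟨r, hr, hall⟩ := key c hc
    have : ∀ s ∈ Set.Ioo (y j) (y (j + 1)), P.eval s = c → s = r j := by
      intro s hs hsc
      obtain ⟨i, hi, e⟩ := hall s (by rw [← Complex.coe_algebraMap, aeval_algebraMap_apply]; simp [hsc])
      have e' : s = r i := by exact_mod_cast e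
      have hri := (hr i hi).1
      rw [← e'] at hri
      rcases lt_trichotomy i j with h | h | h
      · have := hymono (i + 1) j (by omega) (by omega)
        exact absurd (hri.2.trans_le this) (not_lt.2 hs.1.le)
      · rw [← h, e']
      · have := hymono (j + 1) i (by omega) (by omega)
        exact absurd (hs.2.trans_le this) (not_lt.2 hri.1.le)
    intro s hs t ht h1 h2
    rw [this s hs h1, this t ht h2]
  have hband : ∀ j : Fin (n + 1), ∃ α β, y j < α ∧ α < β ∧ β < y (j + 1) ∧
      ∀ s ∈ Set.Ioo (y j) (y (j + 1)), |P.eval s| ≤ K ↔ s ∈ Set.Icc α β := fun j =>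
    exists_band_of_alternating P.continuous hK (hy j (j + 1) (by omega) (by omega))
      (hPy j (by omega)) (hPy (j + 1) (by omega)) (huniq j j.2)
  choose α β h1 h2 h3 h4 using hband
  refine ⟨α, β, h2, fun i j hij => ?_, ?_⟩
  · have hij' : (i : ℕ) < j := hij
    exact ((h3 i).trans_le (hymono (i + 1) j (by omega) (by omega))).trans (h1 j)
  · ext z
    simp only [Set.mem_ofPred_eq, Set.mem_image, Set.mem_iUnion]
    constructor
    · rintro ⟨c, hc, hz⟩
      obtain ⟨r, hr, hall⟩ := key c hc
      obtain ⟨j, hj, rfl⟩ := hall z hz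
      obtain ⟨hm, he⟩ := hr j hj
      exact ⟨r j, ⟨⟨j, hj⟩, (h4 ⟨j, hj⟩ _ hm).1 (by rw [he]; exact hc)⟩, rfl⟩
    · rintro ⟨s, ⟨j, hj⟩, rfl⟩
      refine ⟨P.eval s, (h4 j s ⟨(h1 j).trans_le hj.1, hj.2.trans_lt (h3 j)⟩).2 hj, ?_⟩
      rw [← Complex.coe_algebraMap, aeval_algebraMap_apply]
      simp

end Alternating

/-! ### The bands of the discriminant -/

section Bands

open Polynomial

theorem natDegree_jacobiSol_le (α β : ℕ → ℝ) (p q : ℝ) (n : ℕ) :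
    (jacobiSol α β (X : ℝ[X]) (C p) (C q) n).natDegree ≤ n - 1 := by
  induction n using Nat.twoStepInduction with
  | zero => simp [jacobiSol]
  | one => simp [jacobiSol]
  | more n h1 h2 =>
    rw [jacobiSol_add_two, algebraMap_eq]
    refine (natDegree_smul_le _ _).trans ((natDegree_sub_le _ _).trans (max_le ?_ ?_))
    · refine natDegree_mul_le.trans ?_
      rw [natDegree_X_sub_C]
      omega
    · exact (natDegree_smul_le _ _).trans (by omega)

/-- The classical interlacing property: the `n` zeros of the solution with `u_0 = 0`, `u_1 = 1` at
the site `n + 1` are real and simple, and its value at the site `n` alternates in sign on them. -/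
theorem exists_interlacing_zeros_jacobiSol {α : ℕ → ℝ} (β : ℕ → ℝ) {N : ℕ}
    (hα : ∀ i, 0 < i → i < N → 0 < α i) {n : ℕ} (hn : n + 1 ≤ N) :
    (jacobiSol α β (X : ℝ[X]) 0 1 (n + 1)).natDegree = n ∧
      0 < (jacobiSol α β (X : ℝ[X]) 0 1 (n + 1)).leadingCoeff ∧
      ∃ x : ℕ → ℝ, (∀ i j, i < j → j < n → x i < x j) ∧
        ∀ j < n, (jacobiSol α β (X : ℝ[X]) 0 1 (n + 1)).eval (x j) = 0 ∧
          0 < (-1) ^ (n + 1 + j) * (jacobiSol α β (X : ℝ[X]) 0 1 n).eval (x j) := by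
  induction n with
  | zero => exact ⟨by simp [jacobiSol], by simp [jacobiSol], fun _ => 0, by simp, by simp⟩
  | succ n ih =>
    obtain ⟨hdeg, hlead, x, hx, hzero⟩ := ih (by omega)
    have hαn : 0 < α (n + 1) := hα _ (by omega) (by omega)
    have hrec := jacobiSol_add_two α β (X : ℝ[X]) 0 1 n
    set S := jacobiSol α β (X : ℝ[X]) 0 1 (n + 1)
    set R := jacobiSol α β (X : ℝ[X]) 0 1 n with hR
    set Q := jacobiSol α β (X : ℝ[X]) 0 1 (n + 1 + 1)
    have hS0 : S ≠ 0 := leadingCoeff_ne_zero.1 hlead.ne'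
    have hRd : (α n • R).natDegree ≤ n := by
      have := natDegree_jacobiSol_le α β 0 1 n
      rw [C_0, C_1] at this
      exact (natDegree_smul_le _ _).trans (this.trans (by omega))
    obtain ⟨d1, d2⟩ := natDegree_X_sub_C_mul_sub hdeg hS0 hRd (β (n + 1))
    have hQ : Q = C (α (n + 1))⁻¹ * ((X - C (β (n + 1))) * S - α n • R) := by
      rw [← smul_eq_C_mul]
      exact hrec
    have hQd : Q.natDegree = n + 1 := by
      rw [hQ, natDegree_C_mul (inv_ne_zero hαn.ne'), d1]
    have hQl : 0 < Q.leadingCoeff := by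
      rw [hQ, leadingCoeff_mul, leadingCoeff_C, d2]
      positivity
    have hQx : ∀ j < n, 0 < (-1) ^ (n + j) * Q.eval (x j) := by
      intro j hj
      have hαn' : 0 < α n := hα _ (by omega) (by omega)
      obtain ⟨z1, z2⟩ := hzero j hj
      have : (-1) ^ (n + j) * Q.eval (x j)
          = (α (n + 1))⁻¹ * α n * ((-1) ^ (n + 1 + j) * R.eval (x j)) := by
        rw [hQ]
        simp only [eval_mul, eval_C, eval_sub, eval_X, eval_smul, smul_eq_mul, z1]
        ring
      rw [this]
      positivity
    obtain ⟨y, hy, hQy, hyx⟩ := exists_alternating_extension hQd hQl hx hQx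
    have hr : ∀ j, ∃ r, j < n + 1 → r ∈ Set.Ioo (y j) (y (j + 1)) ∧ Q.eval r = 0 := by
      intro j
      by_cases hj : j < n + 1
      · obtain ⟨r, h1, h2⟩ := exists_mem_Ioo_eq_of_alternating Q.continuous
          (hy j (j + 1) (by omega) (by omega)) (c := 0) (by simp)
          (hQy j (by omega)) (hQy (j + 1) (by omega))
        exact ⟨r, fun _ => ⟨h1, h2⟩⟩
      · exact ⟨0, fun h => absurd h hj⟩
    choose r hr using hr
    have hymono : ∀ i j, i ≤ j → j < n + 2 → y i ≤ y j := fun i j hij hj => by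
      rcases hij.eq_or_lt with rfl | h
      · exact le_rfl
      · exact (hy i j h hj).le
    refine ⟨hQd, hQl, r, fun i j hij hj => ?_, fun j hj => ⟨(hr j hj).2, ?_⟩⟩
    · exact ((hr i (by omega)).1.2.trans_le (hymono (i + 1) j (by omega) (by omega))).trans
        (hr j hj).1.1
    · have hpos := neg_one_pow_mul_eval_pos hdeg hlead hx (fun i hi => (hzero i hi).1)
        (j := j) (y := r j) (by omega)
        (fun i hi => by
          rw [← hyx i (by omega)]
          exact (hymono (i + 1) j (by omega) (by omega)).trans_lt (hr j hj).1.1)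
        (fun i hi hin => by
          rw [← hyx i hin]
          exact (hr j hj).1.2.trans_le (hymono (j + 1) (i + 1) (by omega) (by omega)))
      have e : n + 1 + 1 + j = n + j + 2 := by ring
      rw [e, pow_add]
      simpa using hpos

/-- The discriminant of a periodic Jacobi matrix with period `m + 1` has `m + 1` bands if no zero
of the solution `u` with `u_0 = 0`, `u_1 = 1` at the site `m + 1` is the place of a closed gap. At
such a zero the monodromy matrix is triangular, its diagonal entries are `κ / α 0` and `α 0 / κ` with
`κ = -α m * u_m`, and hence the discriminant exceeds `2` in modulus unless `κ ^ 2 = α 0 ^ 2`. -/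
theorem isUnionOfDistinctIntervals_jacobiDiscr {α β : ℕ → ℝ} {m : ℕ}
    (hα : ∀ i, 0 < i → i < m + 1 → 0 < α i) (hα0 : ∀ i, α i ≠ 0) (hαT : α (m + 1) = α 0)
    (hgap : ∀ x, jacobiSol α β x 0 1 (m + 1) = 0 → (α m * jacobiSol α β x 0 1 m) ^ 2 ≠ α 0 ^ 2) :
    IsUnionOfDistinctIntervals (m + 1)
      {z : ℂ | ∃ c : ℝ, |c| ≤ 2 ∧ jacobiDiscr (m + 1) α β z = (c : ℂ)} := by
  obtain ⟨hdeg, hlead, x, hx, hzero⟩ :=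
    exists_interlacing_zeros_jacobiSol β hα (le_refl (m + 1))
  set S := jacobiSol α β (X : ℝ[X]) 0 1 (m + 1) with hS
  set R := jacobiSol α β (X : ℝ[X]) 0 1 m with hR
  set t := α 0 with ht
  have ht0 : t ≠ 0 := hα0 0
  -- The sign of `t` is not known, so `t * Δ`, whose leading coefficient is positive, replaces `Δ`.
  set P : ℝ[X] := t • jacobiDiscr (m + 1) α β (X : ℝ[X]) with hPdef
  have hP : P = (X - C (β (m + 1))) * S
      - (α m • R - t • jacobiSol α β (X : ℝ[X]) 1 0 (m + 1)) := by
    rw [hPdef, jacobiDiscr, jacobiSol_add_two α β (X : ℝ[X]) 0 1 m, hαT, smul_add, smul_smul,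
      mul_inv_cancel₀ ht0, one_smul, algebraMap_eq]
    ring
  have hRd : (α m • R - t • jacobiSol α β (X : ℝ[X]) 1 0 (m + 1)).natDegree ≤ m := by
    have h1 := natDegree_jacobiSol_le α β 0 1 m
    have h2 := natDegree_jacobiSol_le α β 1 0 (m + 1)
    rw [C_0, C_1] at h1 h2
    exact (natDegree_sub_le _ _).trans (max_le ((natDegree_smul_le _ _).trans (h1.trans (by omega)))
      ((natDegree_smul_le _ _).trans h2))
  obtain ⟨d1, d2⟩ := natDegree_X_sub_C_mul_sub hdeg (leadingCoeff_ne_zero.1 hlead.ne') hRd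
    (β (m + 1))
  rw [← hP] at d1 d2
  have hK : 0 < 2 * |t| := by positivity
  have hev : ∀ (s p q : ℝ) (n : ℕ), (jacobiSol α β (X : ℝ[X]) (C p) (C q) n).eval s
      = jacobiSol α β s p q n := by
    intro s p q n
    have := map_jacobiSol (aeval s) α β (X : ℝ[X]) (C p) (C q) n
    simpa [coe_aeval_eq_eval] using this
  have hPx : ∀ j < m, 2 * |t| < (-1) ^ (m + j) * P.eval (x j) := by
    intro j hj
    obtain ⟨z1, z2⟩ := hzero j hj
    have e1 : jacobiSol α β (x j) 0 1 (m + 1) = 0 := by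
      rw [← hev, C_0, C_1]; exact z1
    have e2 : jacobiSol α β (x j) 0 1 m = R.eval (x j) := by
      rw [← hev, C_0, C_1]
    have hdet := jacobiSol_monodromy_det hα0 β (x j) hαT
    have hg := hgap _ e1
    have hs : t * jacobiSol α β (x j) 0 1 (m + 1 + 1) = -(α m * R.eval (x j)) := by
      rw [jacobiSol_add_two, e1, e2, hαT]
      simp only [smul_eq_mul]
      field_simp
      ring
    have hPe : P.eval (x j) = t * jacobiSol α β (x j) 1 0 (m + 1)
        + t * jacobiSol α β (x j) 0 1 (m + 1 + 1) := by
      rw [hPdef, jacobiDiscr, eval_smul, eval_add, smul_eq_mul, mul_add, ← hev, ← hev, C_0, C_1]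
    rw [e1, mul_zero, sub_zero] at hdet
    rw [e2] at hg
    have hαm : 0 < α m := hα m (by omega) (by omega)
    set k := (-1) ^ (m + j) * (t * jacobiSol α β (x j) 0 1 (m + 1 + 1)) with hk
    have hkpos : 0 < k := by
      rw [hk, hs]
      have : (-1) ^ (m + j) * -(α m * R.eval (x j))
          = α m * ((-1) ^ (m + 1 + j) * R.eval (x j)) := by ring
      rw [this]
      positivity
    have hsq : ((-1 : ℝ) ^ (m + j)) * (-1) ^ (m + j) = 1 := by
      rw [← pow_add]; exact Even.neg_one_pow ⟨_, rfl⟩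
    have hk2 : k ≠ |t| := by
      intro h
      apply hg
      have h' : k ^ 2 = t ^ 2 := by rw [h, sq_abs]
      rw [hk, hs] at h'
      linear_combination h' - (α m * R.eval (x j)) ^ 2 * hsq
    have hprod : ((-1) ^ (m + j) * (t * jacobiSol α β (x j) 1 0 (m + 1))) * k = |t| ^ 2 := by
      rw [hk, sq_abs]
      linear_combination t ^ 2 * hdet + t ^ 2 * jacobiSol α β (x j) 1 0 (m + 1) *
        jacobiSol α β (x j) 0 1 (m + 1 + 1) * hsq
    rw [hPe, mul_add, ← hk]
    have hpos : 0 < (k - |t|) ^ 2 := by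
      have := sub_ne_zero.2 hk2
      positivity
    refine lt_of_mul_lt_mul_right ?_ hkpos.le
    nlinarith
  have hmain := isUnionOfDistinctIntervals_of_alternating d1 (by rw [d2]; exact hlead) hK hx hPx
  convert hmain using 1
  ext z
  simp only [Set.mem_ofPred_eq]
  have haz : aeval z P = (t : ℂ) * jacobiDiscr (m + 1) α β z := by
    rw [hPdef, map_smul, map_jacobiDiscr, aeval_X, Complex.real_smul]
  have htc : (t : ℂ) ≠ 0 := by exact_mod_cast ht0
  rw [haz]
  constructor
  · rintro ⟨c, hc, h⟩
    refine ⟨t * c, ?_, by rw [h]; push_cast; ring⟩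
    rw [abs_mul, mul_comm]
    exact mul_le_mul_of_nonneg_right hc (abs_nonneg t)
  · rintro ⟨c, hc, h⟩
    refine ⟨c / t, ?_, ?_⟩
    · rw [abs_div, div_le_iff₀ (abs_pos.2 ht0)]
      exact hc
    · push_cast
      rw [eq_div_iff htc, mul_comm, h]

end Bands

/-! ### The left shift on square summable sequences -/

section Shift

theorem ellTwo_norm_sq (u : EllTwo) : ‖u‖ ^ 2 = ∑' n, ‖u n‖ ^ 2 := by
  have := lp.norm_rpow_eq_tsum (p := 2) (by norm_num) u
  simpa using this

theorem ellTwo_summable_sq (u : EllTwo) : Summable fun n => ‖u n‖ ^ 2 :=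
  (memlp_two_iff _).1 (lp.memℓp u)

/-- The left shift by `k` places. -/
def leftShift (k : ℕ) (u : EllTwo) : EllTwo :=
  ⟨fun n => u (n + k), (memlp_two_iff _).2
    ((summable_nat_add_iff (f := fun n => ‖u n‖ ^ 2) k).2 (ellTwo_summable_sq u))⟩

@[simp]
theorem leftShift_apply (k : ℕ) (u : EllTwo) (n : ℕ) : leftShift k u n = u (n + k) := rfl

theorem norm_sq_leftShift (k : ℕ) (u : EllTwo) :
    ∑ n ∈ Finset.range k, ‖u n‖ ^ 2 + ‖leftShift k u‖ ^ 2 = ‖u‖ ^ 2 := by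
  rw [ellTwo_norm_sq, ellTwo_norm_sq, ← (ellTwo_summable_sq u).sum_add_tsum_nat_add k]
  rfl

theorem norm_leftShift_le (k : ℕ) (u : EllTwo) : ‖leftShift k u‖ ≤ ‖u‖ := by
  refine le_of_sq_le_sq ?_ (norm_nonneg _)
  rw [← norm_sq_leftShift k u]
  have : 0 ≤ ∑ n ∈ Finset.range k, ‖u n‖ ^ 2 := Finset.sum_nonneg fun _ _ => by positivity
  linarith

theorem norm_leftShift_eq {k : ℕ} {u : EllTwo} (hu : ∀ n < k, u n = 0) :
    ‖leftShift k u‖ = ‖u‖ := by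
  refine (sq_eq_sq₀ (norm_nonneg _) (norm_nonneg _)).1 ?_
  rw [← norm_sq_leftShift k u, Finset.sum_eq_zero, zero_add]
  intro n hn
  simp [hu n (Finset.mem_range.1 hn)]

/-- If `g` is bounded termwise by a sum of `m` translates of `f`, then also in norm. -/
theorem norm_le_of_forall_norm_le_sum_translates {f g : EllTwo} {C : ℝ} (hC : 0 ≤ C) {m : ℕ}
    (h : ∀ n, ‖g n‖ ≤ C * ∑ i ∈ Finset.range m, ‖f (n + i + 1)‖) : ‖g‖ ≤ C * m * ‖f‖ := by
  have hmem : Memℓp (E := fun _ : ℕ => ℂ) (fun n => ((‖f n‖ : ℝ) : ℂ)) 2 := by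
    rw [memlp_two_iff]
    simpa using ellTwo_summable_sq f
  let F : EllTwo := ⟨_, hmem⟩
  have hF : ‖F‖ = ‖f‖ := by
    refine (sq_eq_sq₀ (norm_nonneg _) (norm_nonneg _)).1 ?_
    rw [ellTwo_norm_sq, ellTwo_norm_sq]
    refine tsum_congr fun n => ?_
    change ‖((‖f n‖ : ℝ) : ℂ)‖ ^ 2 = _
    simp
  let G : EllTwo := (C : ℂ) • ∑ i ∈ Finset.range m, leftShift (i + 1) F
  have hG : ∀ n, G n = ((C * ∑ i ∈ Finset.range m, ‖f (n + i + 1)‖ : ℝ) : ℂ) := by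
    intro n
    simp only [G, lp.coeFn_smul, Pi.smul_apply, lp.coeFn_sum, Finset.sum_apply, leftShift_apply,
      smul_eq_mul]
    push_cast
    rfl
  have h1 : ‖g‖ ≤ ‖G‖ := by
    refine lp.norm_mono (by norm_num) fun n => (h n).trans ?_
    rw [hG, Complex.norm_real]
    exact le_abs_self _
  refine h1.trans ?_
  rw [norm_smul, Complex.norm_real, Real.norm_of_nonneg hC, mul_assoc]
  refine mul_le_mul_of_nonneg_left ?_ hC
  refine (norm_sum_le _ _).trans ?_
  refine (Finset.sum_le_card_nsmul _ _ ‖f‖ fun i _ => ?_).trans (by simp)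
  exact (norm_leftShift_le _ _).trans hF.le

/-- If `|z| > 1`, the second order recurrence with characteristic roots `z` and `w = 1 / z` controls
square summable sequences that vanish at first: `L ^ T - z` is bounded below everywhere, and
`L ^ T - w` where `L ^ T` is isometric. -/
theorem hyperbolic_recurrence_norm_le {T : ℕ} {z w : ℂ} (hz : 1 ≤ ‖z‖) (hzw : z * w = 1)
    {u g : EllTwo} (hu : ∀ n < T + T, u n = 0)
    (hg : ∀ n, g n = u (n + T + T) - (z + w) * u (n + T) + u n) :
    (‖z‖ - 1) * (1 - ‖w‖) * ‖u‖ ≤ ‖g‖ := by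
  set v : EllTwo := leftShift T u - z • u with hv
  have hv0 : ∀ n < T, v n = 0 := by
    intro n hn
    rw [hv, lp.coeFn_sub, lp.coeFn_smul, Pi.sub_apply, Pi.smul_apply, leftShift_apply,
      hu n (by omega), hu (n + T) (by omega), smul_zero, sub_zero]
  have h1 : (‖z‖ - 1) * ‖u‖ ≤ ‖v‖ := by
    have : z • u = leftShift T u - v := by rw [hv]; abel
    have h := norm_sub_le (leftShift T u) v
    rw [← this, norm_smul] at h
    have := norm_leftShift_le T u
    linarith
  have h2 : (1 - ‖w‖) * ‖v‖ ≤ ‖g‖ := by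
    have : leftShift T v = g + w • v := by
      ext n
      simp only [hv, leftShift_apply, lp.coeFn_add, lp.coeFn_sub, lp.coeFn_smul, Pi.add_apply,
        Pi.sub_apply, Pi.smul_apply, smul_eq_mul, hg]
      linear_combination u n * hzw
    have h := norm_add_le g (w • v)
    rw [← this, norm_leftShift_eq hv0, norm_smul] at h
    linarith
  have hw : ‖w‖ ≤ 1 := by
    have h := congrArg norm hzw
    rw [norm_mul, norm_one] at h
    nlinarith [norm_nonneg w]
  nlinarith [mul_le_mul_of_nonneg_left h1 (sub_nonneg.2 hw)]

end Shift

/-! ### Fredholm operators on a Hilbert space -/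

section Fredholm

/-- An operator which is bounded below on a closed subspace of finite codimension, and maps it
onto a subspace with finite dimensional orthogonal complement, is Fredholm. -/
theorem ContinuousLinearMap.isFredholm_of_bddBelow {H : Type*} [NormedAddCommGroup H]
    [InnerProductSpace ℂ H] [CompleteSpace H] (A : H →L[ℂ] H) (E : Submodule ℂ H)
    (hE : IsClosed (E : Set H)) [E.CoFG] {c : ℝ} (hc : 0 < c) (hA : ∀ u ∈ E, c * ‖u‖ ≤ ‖A u‖)
    (hfin : FiniteDimensional ℂ (E.map (A : H →ₗ[ℂ] H))ᗮ) : A.IsFredholm := by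
  set F := E.map (A : H →ₗ[ℂ] H) with hF
  have : CompleteSpace E := hE.completeSpace_coe
  have hmaps : Set.MapsTo A E F := fun x hx => Submodule.mem_map_of_mem hx
  have hanti : AntilipschitzWith (Real.toNNReal c⁻¹) (A ∘L E.subtypeL) := by
    refine ContinuousLinearMap.antilipschitz_of_bound _ fun u => ?_
    have := hA u u.2
    rw [Real.coe_toNNReal _ (inv_nonneg.2 hc.le), inv_mul_eq_div, le_div_iff₀ hc, mul_comm]
    exact this
  have hFcl : IsClosed (F : Set H) := by
    have h := hanti.isClosed_range (A ∘L E.subtypeL).uniformContinuous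
    convert h using 1
    ext y
    simp [hF]
  have : CompleteSpace F := hFcl.completeSpace_coe
  have : F.CoFG := by
    refine Submodule.FG.cofg_of_isCompl (S := Fᗮ) (T := F) (Submodule.isCompl_orthogonal F).symm ?_
    exact (Submodule.fg_iff_finiteDimensional _).2 hfin
  refine ContinuousLinearMap.IsFredholm.of_isInvertible_restrict hE hFcl hmaps ?_
  refine ⟨ContinuousLinearEquiv.ofBijective (A.restrict hmaps) ?_ ?_, ?_⟩
  · rw [LinearMap.ker_eq_bot']
    intro u hu
    have h0 : A u = 0 := congrArg Subtype.val hu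
    have := hA u u.2
    rw [h0, norm_zero] at this
    have : ‖(u : H)‖ ≤ 0 := by
      by_contra! hpos
      have := mul_pos hc hpos
      linarith
    exact Subtype.ext (norm_le_zero_iff.1 this)
  · rw [LinearMap.range_eq_top]
    rintro ⟨y, hy⟩
    obtain ⟨x, hx, rfl⟩ := hy
    exact ⟨⟨x, hx⟩, rfl⟩
  · ext u
    rfl

/-- A Fredholm operator admits, for each vector of its range, a preimage of controlled norm. -/
theorem ContinuousLinearMap.IsFredholm.exists_preimage_norm_le {H : Type*} [NormedAddCommGroup H]
    [NormedSpace ℂ H] {A : H →L[ℂ] H} (hA : A.IsFredholm) :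
    ∃ C : ℝ, 0 ≤ C ∧ ∀ u, ∃ v, A v = A u ∧ ‖v‖ ≤ C * ‖A u‖ := by
  obtain ⟨pkg⟩ := hA.nonempty_fredholmPackage
  set B : pkg.decCodom.X₁ →L[ℂ] pkg.decDom.X₁ := pkg.equiv.symm.toContinuousLinearMap with hB
  refine ⟨‖B‖, B.opNorm_nonneg, fun u => ?_⟩
  have hAu : ∀ x, A x = (pkg.equiv (pkg.decDom.proj x) : H) := fun x => by
    conv_lhs => rw [pkg.eq_equiv]
    rfl
  refine ⟨(pkg.decDom.proj u : H), ?_, ?_⟩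
  · rw [hAu, hAu]
    congr 2
    exact Submodule.projectionOntoL_apply_left _ _
  · have h := B.le_opNorm (pkg.equiv (pkg.decDom.proj u))
    rw [hB, ContinuousLinearEquiv.coe_coe, ContinuousLinearEquiv.symm_apply_apply] at h
    rw [hAu u]
    exact h

end Fredholm

/-! ### Local estimates for the inhomogeneous recurrence -/

section Local

theorem exists_isJacobiSol_of_values {α : ℕ → ℝ} (hα : ∀ n, α n ≠ 0) (β : ℕ → ℝ) (z : ℂ) (n : ℕ)
    (x y : ℂ) : ∃ v, IsJacobiSol α β z v ∧ v n = x ∧ v (n + 1) = y := by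
  set c := jacobiSol α β z 1 0
  set s := jacobiSol α β z 0 1
  have hW : c n * s (n + 1) - c (n + 1) * s n ≠ 0 := by
    intro h
    have := jacobiSol_wronskian hα β z n
    rw [h, smul_zero] at this
    have : α 0 = 0 := by simpa using this.symm
    exact hα 0 this
  set W := c n * s (n + 1) - c (n + 1) * s n with hWdef
  refine ⟨_, (isJacobiSol_jacobiSol hα β z 1 0).comb (isJacobiSol_jacobiSol hα β z 0 1)
    ((x * s (n + 1) - y * s n) / W) ((c n * y - c (n + 1) * x) / W), ?_, ?_⟩
  · change (x * s (n + 1) - y * s n) / W * c n + (c n * y - c (n + 1) * x) / W * s n = x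
    field_simp
    rw [hWdef]
    ring
  · change (x * s (n + 1) - y * s n) / W * c (n + 1) + (c n * y - c (n + 1) * x) / W * s (n + 1) = y
    field_simp
    rw [hWdef]
    ring

/-- A solution of the inhomogeneous recurrence which vanishes at two neighbouring sites is bounded,
at a fixed distance, by the inhomogeneity in between, uniformly in the site. -/
theorem exists_local_bound {α β : ℕ → ℝ} {K : ℝ} (hα : ∀ n, α n ≠ 0) (hK1 : ∀ n, |α n| ≤ K)
    (hK2 : ∀ n, |(α n)⁻¹| ≤ K) (z : ℂ) (hK3 : ∀ n, ‖z - β n‖ ≤ K) (m : ℕ) :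
    ∃ C : ℝ, 0 ≤ C ∧ ∀ (n : ℕ) (d g : ℕ → ℂ), d 0 = 0 → d 1 = 0 →
      (∀ i, (α (n + i + 1) : ℂ) * d (i + 2)
        = (z - β (n + i + 1)) * d (i + 1) - α (n + i) * d i + g i) →
      ∀ k ≤ m + 1, ‖d k‖ ≤ C * ∑ i ∈ Finset.range m, ‖g i‖ := by
  have hK0 : 0 ≤ K := (abs_nonneg _).trans (hK1 0)
  induction m with
  | zero =>
    refine ⟨0, le_rfl, fun n d g h0 h1 _ k hk => ?_⟩
    have : k = 0 ∨ k = 1 := by omega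
    rcases this with rfl | rfl <;> simp [h0, h1]
  | succ m ih =>
    obtain ⟨C, hC, h⟩ := ih
    refine ⟨C + K * (K * C + K * C + 1), by positivity, fun n d g h0 h1 hrec k hk => ?_⟩
    have hb := h n d g h0 h1 hrec
    rw [Finset.sum_range_succ]
    set M := ∑ i ∈ Finset.range m, ‖g i‖ with hM
    have hM0 : 0 ≤ M := Finset.sum_nonneg fun _ _ => norm_nonneg _
    have hg0 := norm_nonneg (g m)
    rcases Nat.lt_or_ge k (m + 2) with hlt | hge
    · refine (hb k (by omega)).trans ?_
      have : 0 ≤ K * (K * C + K * C + 1) := by positivity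
      nlinarith [mul_nonneg this (add_nonneg hM0 hg0), mul_nonneg hC hg0]
    · have : k = m + 2 := by omega
      subst this
      have hαc : (α (n + m + 1) : ℂ) ≠ 0 := by exact_mod_cast hα _
      have e : d (m + 2) = ((α (n + m + 1))⁻¹ : ℝ) *
          ((z - β (n + m + 1)) * d (m + 1) - α (n + m) * d m + g m) := by
        rw [← hrec m]
        push_cast
        field_simp
      have b1 := hb (m + 1) (by omega)
      have b0 := hb m (by omega)
      have n1 : ‖(z - β (n + m + 1)) * d (m + 1)‖ ≤ K * (C * M) := by
        rw [norm_mul]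
        exact mul_le_mul (hK3 _) b1 (norm_nonneg _) hK0
      have n2 : ‖(α (n + m) : ℂ) * d m‖ ≤ K * (C * M) := by
        rw [norm_mul, Complex.norm_real]
        exact mul_le_mul (hK1 _) b0 (norm_nonneg _) hK0
      have n3 : ‖(z - β (n + m + 1)) * d (m + 1) - α (n + m) * d m + g m‖
          ≤ K * (C * M) + K * (C * M) + ‖g m‖ :=
        (norm_add_le _ _).trans (add_le_add ((norm_sub_le _ _).trans (add_le_add n1 n2)) le_rfl)
      rw [e, norm_mul, Complex.norm_real]
      refine (mul_le_mul (hK2 _) n3 (norm_nonneg _) hK0).trans ?_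
      have h1 : 0 ≤ K * (K * C + K * C) * ‖g m‖ := by positivity
      have h2 : 0 ≤ K * M := by positivity
      nlinarith [mul_nonneg hC (add_nonneg hM0 hg0)]

/-- The combination of translates of `u` which the Cayley–Hamilton identity annihilates for
solutions is, in general, bounded by nearby values of `(J - z) u`. -/
theorem exists_cayleyHamilton_bound {α β : ℕ → ℝ} {K : ℝ} (hα : ∀ n, α n ≠ 0)
    (hK1 : ∀ n, |α n| ≤ K) (hK2 : ∀ n, |(α n)⁻¹| ≤ K) (z : ℂ) (hK3 : ∀ n, ‖z - β n‖ ≤ K) {T : ℕ}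
    (hαT : ∀ n, α (n + T) = α n) (hβT : ∀ n, β (n + T) = β n) :
    ∃ C : ℝ, 0 ≤ C ∧ ∀ (u : ℕ → ℂ) (n : ℕ),
      ‖u (n + T + T) - jacobiDiscr T α β z * u (n + T) + u n‖ ≤
        C * ∑ i ∈ Finset.range (T + T),
          ‖jacobiAction α β u (n + i + 1) - z * u (n + i + 1)‖ := by
  obtain ⟨C, hC, h⟩ := exists_local_bound hα hK1 hK2 z hK3 (T + T)
  refine ⟨C + ‖jacobiDiscr T α β z‖ * C, by positivity, fun u n => ?_⟩
  obtain ⟨v, hv, v0, v1⟩ := exists_isJacobiSol_of_values hα β z n (u n) (u (n + 1))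
  have hCH := hv.cayleyHamilton hα hαT hβT n
  have hb := h n (fun i => u (n + i) - v (n + i))
    (fun i => jacobiAction α β u (n + i + 1) - z * u (n + i + 1)) (by simp [v0]) (by simp [v1])
    (fun i => by
      have := hv (n + i)
      simp only [Complex.real_smul, Complex.coe_algebraMap] at this
      simp only [jacobiAction]
      rw [show n + (i + 2) = n + i + 2 by ring, show n + (i + 1) = n + i + 1 by ring]
      linear_combination -this)
  have b2 := hb (T + T) (by omega)
  have b1 := hb T (by omega)
  set S := ∑ i ∈ Finset.range (T + T), ‖jacobiAction α β u (n + i + 1) - z * u (n + i + 1)‖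
  have e : u (n + T + T) - jacobiDiscr T α β z * u (n + T) + u n
      = (u (n + (T + T)) - v (n + (T + T)))
        - jacobiDiscr T α β z * (u (n + T) - v (n + T)) := by
    rw [← add_assoc]
    linear_combination hCH - v0
  rw [e, add_mul, mul_assoc]
  refine (norm_sub_le _ _).trans (add_le_add b2 ?_)
  rw [norm_mul]
  exact mul_le_mul_of_nonneg_left b1 (norm_nonneg _)

end Local

/-! ### Fredholmness off the bands -/

section OffBands

theorem periodicExt_add_period {T : ℕ} [NeZero T] (c : Fin T → ℝ) (n : ℕ) :
    periodicExt c (n + T) = periodicExt c n := by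
  simp [periodicExt, Fin.ofNat]

theorem periodicJacobi_sub_smul_apply {T : ℕ} [NeZero T] (a b : Fin T → ℝ) (z : ℂ) (u : EllTwo)
    (n : ℕ) : (periodicJacobi a b - z • ContinuousLinearMap.id ℂ EllTwo) u n
      = jacobiAction (periodicExt a) (periodicExt b) u n - z * u n := by
  rw [← periodicJacobi_apply]
  rfl

/-- The larger one of two numbers with product `1` and sum `δ` is strictly outside the unit circle,
unless `δ` lies in the real interval `[-2, 2]`. -/
theorem exists_hyperbolic_roots {δ : ℂ} (hδ : ¬ ∃ c : ℝ, |c| ≤ 2 ∧ δ = c) :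
    ∃ z w : ℂ, z * w = 1 ∧ z + w = δ ∧ 1 < ‖z‖ := by
  obtain ⟨s, hs⟩ := IsAlgClosed.exists_pow_nat_eq (δ ^ 2 - 4) (n := 2) (by norm_num)
  have hmul : (δ + s) / 2 * ((δ - s) / 2) = 1 := by linear_combination -hs / 4
  have hadd : (δ + s) / 2 + (δ - s) / 2 = δ := by ring
  generalize (δ + s) / 2 = z at hmul hadd
  generalize (δ - s) / 2 = w at hmul hadd
  have hn := congrArg norm hmul
  rw [norm_mul, norm_one] at hn
  rcases lt_trichotomy ‖z‖ 1 with h | h | h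
  · refine ⟨w, z, by rw [mul_comm, hmul], by rw [add_comm, hadd], ?_⟩
    by_contra! hw
    have := mul_le_mul_of_nonneg_left hw (norm_nonneg z)
    linarith
  · exfalso
    apply hδ
    refine ⟨2 * z.re, ?_, ?_⟩
    · rw [abs_mul, abs_two]
      have := Complex.abs_re_le_norm z
      linarith
    · have hz0 : z ≠ 0 := fun h0 => by simp [h0] at h
      have hconj : w = (starRingEnd ℂ) z := by
        have h2 : z * (starRingEnd ℂ) z = 1 := by
          rw [Complex.mul_conj, Complex.normSq_eq_norm_sq, h]
          norm_num
        exact mul_left_cancel₀ hz0 (hmul.trans h2.symm)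
      rw [← hadd, hconj, Complex.add_conj]
  · exact ⟨z, w, hmul, hadd, h⟩

variable {T : ℕ} [NeZero T] {a b : Fin T → ℝ}

theorem periodicJacobi_sub_smul_single (a b : Fin T → ℝ) (z : ℂ) (k : ℕ) :
    (periodicJacobi a b - z • ContinuousLinearMap.id ℂ EllTwo) (lp.single 2 (k + 1) 1)
      = lp.single 2 k (periodicExt a k : ℂ) + lp.single 2 (k + 1) (periodicExt b (k + 1) - z)
        + lp.single 2 (k + 2) (periodicExt a (k + 1) : ℂ) := by
  ext n
  rw [periodicJacobi_sub_smul_apply]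
  simp only [lp.coeFn_add, Pi.add_apply, lp.coeFn_single]
  rcases n with _ | n
  · simp only [jacobiAction, Pi.single_apply]
    rcases k with _ | k <;> simp
  · simp only [jacobiAction, Pi.single_apply]
    by_cases h1 : n = k + 1
    · subst h1
      simp
      omega
    · by_cases h2 : n = k
      · subst h2
        simp
      · by_cases h3 : n + 1 = k
        · subst h3
          simp
          omega
        · simp [h1, h2, h3]

/-- A vector orthogonal to the image under `J - z` of the sequences vanishing up to the site `m` solves the
adjoint recurrence from there on, so these vectors form a finite dimensional space. -/
theorem finiteDimensional_orthogonal_map (ha : ∀ i, a i ≠ 0) (z : ℂ) {m : ℕ} (E : Submodule ℂ EllTwo)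
    (hE : ∀ u : EllTwo, (∀ n < m + 1, u n = 0) → u ∈ E) :
    FiniteDimensional ℂ (E.map ((periodicJacobi a b - z • ContinuousLinearMap.id ℂ EllTwo :
      EllTwo →L[ℂ] EllTwo) : EllTwo →ₗ[ℂ] EllTwo))ᗮ := by
  set A := periodicJacobi a b - z • ContinuousLinearMap.id ℂ EllTwo with hA
  let ev : EllTwo →ₗ[ℂ] (Fin (m + 2) → ℂ) :=
    LinearMap.pi fun i => (lp.evalCLM ℂ (fun _ : ℕ => ℂ) 2 (i : ℕ) : EllTwo →ₗ[ℂ] ℂ)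
  refine FiniteDimensional.of_injective
    (ev ∘ₗ (E.map (A : EllTwo →ₗ[ℂ] EllTwo))ᗮ.subtype) ?_
  rw [← LinearMap.ker_eq_bot, LinearMap.ker_eq_bot']
  rintro ⟨y, hy⟩ hy0
  have h0 : ∀ n < m + 2, y n = 0 := fun n hn => congrFun hy0 ⟨n, hn⟩
  have hrow : ∀ k, m ≤ k → (periodicExt a k : ℂ) * y k
      + (periodicExt b (k + 1) - (starRingEnd ℂ) z) * y (k + 1)
      + periodicExt a (k + 1) * y (k + 2) = 0 := by
    intro k hk
    have hmem : lp.single 2 (k + 1) (1 : ℂ) ∈ E := hE _ fun n hn => by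
      rw [lp.single_apply_ne]
      omega
    have h := (Submodule.mem_orthogonal _ _).1 hy _ (Submodule.mem_map_of_mem hmem)
    have h' : inner ℂ (A (lp.single 2 (k + 1) (1 : ℂ))) y = 0 := h
    rw [hA, periodicJacobi_sub_smul_single, inner_add_left, inner_add_left, lp.inner_single_left,
      lp.inner_single_left, lp.inner_single_left] at h'
    simp only [RCLike.inner_apply, map_sub, Complex.conj_ofReal] at h'
    linear_combination h'
  have hall : ∀ n, y n = 0 := by
    intro n
    induction n using Nat.strong_induction_on with
    | _ n ih =>
      by_cases hn : n < m + 2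
      · exact h0 n hn
      · obtain ⟨k, rfl⟩ := Nat.exists_eq_add_of_le' (show 2 ≤ n by omega)
        have h := hrow k (by omega)
        rw [ih k (by omega), ih (k + 1) (by omega), mul_zero, mul_zero, zero_add, zero_add] at h
        have hne : (periodicExt a (k + 1) : ℂ) ≠ 0 := by exact_mod_cast ha _
        exact (mul_eq_zero.1 h).resolve_left hne
  exact Subtype.ext (lp.ext (funext hall))

theorem isFredholm_periodicJacobi_sub_smul (ha : ∀ i, a i ≠ 0) {z : ℂ}
    (hz : ¬ ∃ c : ℝ, |c| ≤ 2 ∧ jacobiDiscr T (periodicExt a) (periodicExt b) z = c) :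
    (periodicJacobi a b - z • ContinuousLinearMap.id ℂ EllTwo).IsFredholm := by
  obtain ⟨l, w, hlw, hsum, hl⟩ := exists_hyperbolic_roots hz
  set A := periodicJacobi a b - z • ContinuousLinearMap.id ℂ EllTwo with hA
  have hT : 0 < T := Nat.pos_of_ne_zero (NeZero.ne T)
  set K : ℝ := max ‖a‖ (max ‖(fun i => (a i)⁻¹ : Fin T → ℝ)‖ (‖z‖ + ‖b‖)) with hK
  obtain ⟨C, hC, hbound⟩ := exists_cayleyHamilton_bound (α := periodicExt a) (β := periodicExt b)
    (K := K) (fun n => ha _) (fun n => (abs_periodicExt_le a n).trans (le_max_left _ _))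
    (fun n => (abs_periodicExt_le (fun i => (a i)⁻¹) n).trans
      ((le_max_left _ _).trans (le_max_right _ _))) z
    (fun n => by
      refine (norm_sub_le _ _).trans (le_trans ?_ ((le_max_right _ _).trans (le_max_right _ _)))
      rw [Complex.norm_real]
      exact add_le_add le_rfl (abs_periodicExt_le b n))
    (periodicExt_add_period a) (periodicExt_add_period b)
  let ev : EllTwo →L[ℂ] (Fin (T + T) → ℂ) :=
    ContinuousLinearMap.pi fun i => lp.evalCLM ℂ (fun _ : ℕ => ℂ) 2 (i : ℕ)
  set E := LinearMap.ker (ev : EllTwo →ₗ[ℂ] (Fin (T + T) → ℂ)) with hEdef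
  have hmemE : ∀ u, u ∈ E ↔ ∀ n < T + T, u n = 0 := by
    intro u
    rw [hEdef, LinearMap.mem_ker]
    exact ⟨fun h n hn => congrFun h ⟨n, hn⟩, fun h => funext fun i => h i i.2⟩
  have : E.CoFG := Submodule.CoFG.ker _
  have hEcl : IsClosed (E : Set EllTwo) := ContinuousLinearMap.isClosed_ker ev
  have hw : ‖w‖ < 1 := by
    have h := congrArg norm hlw
    rw [norm_mul, norm_one] at h
    by_contra! hw
    have := mul_le_mul_of_nonneg_left hw (norm_nonneg l)
    linarith
  have hc : 0 < (‖l‖ - 1) * (1 - ‖w‖) := mul_pos (sub_pos.2 hl) (sub_pos.2 hw)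
  have hC' : 0 < C * (T + T : ℕ) + 1 := by positivity
  refine ContinuousLinearMap.isFredholm_of_bddBelow A E hEcl
    (c := (‖l‖ - 1) * (1 - ‖w‖) / (C * (T + T : ℕ) + 1)) (by positivity) ?_ ?_
  · intro u hu
    let g : EllTwo := leftShift (T + T) u - (l + w) • leftShift T u + u
    have hg : ∀ n, g n = u (n + T + T) - (l + w) * u (n + T) + u n := fun n => by
      rw [add_assoc]
      rfl
    have h1 := hyperbolic_recurrence_norm_le hl.le hlw ((hmemE u).1 hu) hg
    have h2 := norm_le_of_forall_norm_le_sum_translates (f := A u) (g := g) hC (m := T + T)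
      (fun n => by
        rw [hg, hsum]
        have := hbound u n
        simpa only [hA, periodicJacobi_sub_smul_apply] using this)
    rw [div_mul_eq_mul_div, div_le_iff₀ hC']
    have := norm_nonneg (A u)
    linarith
  · exact finiteDimensional_orthogonal_map (m := T + T - 1) ha z E fun u hu =>
      (hmemE u).2 fun n hn => hu n (by omega)

end OffBands

/-! ### Failure of Fredholmness on the bands -/

section OnBands

/-- On the bands there is a nontrivial Floquet solution whose multiplier lies on the unit circle. -/
theorem exists_floquet_solution {α : ℕ → ℝ} (hα : ∀ n, α n ≠ 0) {β : ℕ → ℝ} {T : ℕ}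
    (hαT : ∀ n, α (n + T) = α n) (hβT : ∀ n, β (n + T) = β n) {z : ℂ} {c : ℝ} (hc : |c| ≤ 2)
    (hz : jacobiDiscr T α β z = c) :
    ∃ φ : ℕ → ℂ, IsJacobiSol α β z φ ∧ (∀ n, ‖φ (n + T)‖ = ‖φ n‖) ∧ ∃ n ≤ 1, φ n ≠ 0 := by
  have hc4 : 0 ≤ 1 - (c / 2) ^ 2 := by
    have : c ^ 2 ≤ 2 ^ 2 := sq_le_sq' (by linarith [(abs_le.1 hc).1]) (abs_le.1 hc).2
    linarith
  have hsq := Real.sq_sqrt hc4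
  set r := √(1 - (c / 2) ^ 2)
  set l : ℂ := ⟨c / 2, r⟩ with hl
  have hlnorm : ‖l‖ = 1 := by
    have : ‖l‖ ^ 2 = 1 := by
      rw [← Complex.normSq_eq_norm_sq, hl, Complex.normSq_mk]
      linarith
    exact (pow_eq_one_iff_of_nonneg (norm_nonneg _) two_ne_zero).1 this
  have hchar : l ^ 2 - c * l + 1 = 0 := by
    apply Complex.ext
    · simp [hl, pow_two]
      linarith
    · simp [hl, pow_two]
      ring
  have hdet := jacobiSol_monodromy_det hα β z (T := T) (by simpa using hαT 0)
  rw [jacobiDiscr] at hz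
  have hM : (!![jacobiSol α β z 1 0 T - l, jacobiSol α β z 0 1 T;
      jacobiSol α β z 1 0 (T + 1), jacobiSol α β z 0 1 (T + 1) - l]).det = 0 := by
    rw [Matrix.det_fin_two_of]
    linear_combination hdet + hchar - l * hz
  obtain ⟨v, hv0, hv⟩ := Matrix.exists_mulVec_eq_zero_iff.2 hM
  have e0 := congrFun hv 0
  have e1 := congrFun hv 1
  simp [Matrix.mulVec, dotProduct, Fin.sum_univ_two] at e0 e1
  have hφ := (isJacobiSol_jacobiSol hα β z (1 : ℂ) 0).comb (isJacobiSol_jacobiSol hα β z 0 1)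
    (v 0) (v 1)
  refine ⟨_, hφ, fun n => ?_, ?_⟩
  · have h := (hφ.shift hαT hβT).eq_of_eq hα (hφ.comb hφ l 0)
      (by simp [jacobiSol]; linear_combination e0)
      (by simp only [add_comm 1 T]; simp [jacobiSol]; linear_combination e1) n
    simp only [zero_mul, add_zero] at h
    rw [h, norm_mul, hlnorm, one_mul]
  · by_contra! h
    apply hv0
    have h0 := h 0 (by norm_num)
    have h1 := h 1 le_rfl
    simp [jacobiSol] at h0 h1
    funext i
    fin_cases i
    · exact h0
    · exact h1

theorem norm_le_of_support_subset {f : EllTwo} {s : Finset ℕ} (hs : ∀ n ∉ s, f n = 0) {M : ℝ}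
    (hM : ∀ n, ‖f n‖ ≤ M) : ‖f‖ ≤ s.card * M := by
  have hf : f = ∑ n ∈ s, lp.single 2 n (f n) := by
    ext n
    rw [lp.coeFn_sum, Finset.sum_apply]
    simp only [lp.coeFn_single, Pi.single_apply, Finset.sum_ite_eq]
    split_ifs with h
    · rfl
    · exact hs n h
  rw [hf]
  refine (norm_sum_le _ _).trans ((Finset.sum_le_card_nsmul _ _ M fun n _ => ?_).trans (by simp))
  rw [lp.norm_single (by norm_num)]
  exact hM n

variable {T : ℕ} [NeZero T] {a b : Fin T → ℝ}

/-- An element of the kernel of `J - z` is determined by its first entry. -/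
theorem eq_zero_of_mem_ker (ha : ∀ i, a i ≠ 0) {z : ℂ} {k : EllTwo}
    (hk : (periodicJacobi a b - z • ContinuousLinearMap.id ℂ EllTwo) k = 0) (h0 : k 0 = 0) :
    k = 0 := by
  have hrow : ∀ n, jacobiAction (periodicExt a) (periodicExt b) k n - z * k n = 0 := fun n => by
    rw [← periodicJacobi_sub_smul_apply, hk]
    rfl
  have hα : ∀ n, periodicExt a n ≠ 0 := fun n => ha _
  have h1 : k 1 = 0 := by
    have := hrow 0
    simpa [jacobiAction, h0, hα 0] using this
  have hsol : IsJacobiSol (periodicExt a) (periodicExt b) z (k : ℕ → ℂ) := fun n => by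
    have := hrow (n + 1)
    simp only [jacobiAction] at this
    simp only [Complex.real_smul, Complex.coe_algebraMap]
    linear_combination this
  have hzero : IsJacobiSol (periodicExt a) (periodicExt b) z (fun _ => (0 : ℂ)) := fun n => by simp
  exact lp.ext (funext fun n => hsol.eq_of_eq hα hzero h0 h1 n)

theorem exists_ker_norm_le (ha : ∀ i, a i ≠ 0) (z : ℂ) : ∃ C : ℝ, 0 ≤ C ∧ ∀ k : EllTwo,
    (periodicJacobi a b - z • ContinuousLinearMap.id ℂ EllTwo) k = 0 → ‖k‖ ≤ C * ‖k 0‖ := by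
  by_cases h : ∃ ψ : EllTwo,
      (periodicJacobi a b - z • ContinuousLinearMap.id ℂ EllTwo) ψ = 0 ∧ ψ 0 ≠ 0
  · obtain ⟨ψ, hψ, hψ0⟩ := h
    refine ⟨‖ψ‖ / ‖ψ 0‖, by positivity, fun k hk => ?_⟩
    have : k - (k 0 / ψ 0) • ψ = 0 := by
      refine eq_zero_of_mem_ker (b := b) ha (z := z) ?_ ?_
      · rw [map_sub, map_smul, hk, hψ, smul_zero, sub_zero]
      · rw [lp.coeFn_sub, lp.coeFn_smul, Pi.sub_apply, Pi.smul_apply, smul_eq_mul,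
          div_mul_cancel₀ _ hψ0, sub_self]
    rw [sub_eq_zero] at this
    conv_lhs => rw [this]
    rw [norm_smul, norm_div]
    exact le_of_eq (by ring)
  · push Not at h
    refine ⟨0, le_rfl, fun k hk => ?_⟩
    rw [eq_zero_of_mem_ker ha hk (h k hk)]
    simp

/-- Cutting a bounded Floquet solution off to `[T, (N + 2) T)` gives vectors `u` of norm at least
`√N` times a constant, while `(J - z) u` is bounded, since it lives at the two ends of the cut. -/
theorem exists_approximate_eigenvectors (ha : ∀ i, a i ≠ 0) {z : ℂ} {c : ℝ} (hc : |c| ≤ 2)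
    (hz : jacobiDiscr T (periodicExt a) (periodicExt b) z = c) :
    ∃ δ M : ℝ, 0 < δ ∧ ∀ N : ℕ, ∃ u : EllTwo, u 0 = 0 ∧ N * δ ≤ ‖u‖ ^ 2 ∧
      ‖(periodicJacobi a b - z • ContinuousLinearMap.id ℂ EllTwo) u‖ ≤ M := by
  have hT : 0 < T := Nat.pos_of_ne_zero (NeZero.ne T)
  obtain ⟨φ, hφ, hper, n₀, hn₀, hne⟩ := exists_floquet_solution (α := periodicExt a)
    (fun n => ha _) (periodicExt_add_period a) (periodicExt_add_period b) hc hz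
  have hper' : ∀ n k, ‖φ (n + k * T)‖ = ‖φ n‖ := by
    intro n k
    induction k with
    | zero => simp
    | succ k ih => rw [Nat.succ_mul, ← add_assoc, hper, ih]
  set B := ∑ i ∈ Finset.range T, ‖φ i‖ with hB
  have hB0 : 0 ≤ B := Finset.sum_nonneg fun _ _ => norm_nonneg _
  have hφB : ∀ n, ‖φ n‖ ≤ B := by
    intro n
    rw [← Nat.mod_add_div' n T, hper']
    exact Finset.single_le_sum (f := fun i => ‖φ i‖) (fun _ _ => norm_nonneg _)
      (Finset.mem_range.2 (Nat.mod_lt n hT))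
  refine ⟨‖φ n₀‖ ^ 2, 4 * (‖a‖ * B + ‖b‖ * B + ‖a‖ * B + ‖z‖ * B),
    by have := norm_pos_iff.2 hne; positivity, fun N => ?_⟩
  set q := (N + 2) * T with hq
  have hTq : 2 * T ≤ q := Nat.mul_le_mul_right T (by omega)
  set w : ℕ → ℂ := fun n => if T ≤ n ∧ n < q then φ n else 0 with hw
  have hwin : ∀ n, T ≤ n → n < q → w n = φ n := fun n h1 h2 => if_pos ⟨h1, h2⟩
  have hwout : ∀ n, ¬ (T ≤ n ∧ n < q) → w n = 0 := fun n h => if_neg h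
  have hwB : ∀ n, ‖w n‖ ≤ B := fun n => by
    by_cases h : T ≤ n ∧ n < q
    · rw [hwin n h.1 h.2]
      exact hφB n
    · rw [hwout n h, norm_zero]
      exact hB0
  have hmem : Memℓp (E := fun _ : ℕ => ℂ) w 2 := by
    rw [memlp_two_iff]
    refine summable_of_ne_finset_zero (s := Finset.range q) fun n hn => ?_
    rw [Finset.mem_range] at hn
    simp [hwout n (by omega)]
  refine ⟨⟨w, hmem⟩, hwout 0 (by omega), ?_, ?_⟩
  · have hinj : Function.Injective fun k => n₀ + (k + 1) * T := by
      intro i j hij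
      have : (i + 1) * T = (j + 1) * T := by simpa using hij
      have := Nat.eq_of_mul_eq_mul_right hT this
      omega
    have hsum := (ellTwo_summable_sq ⟨w, hmem⟩).sum_le_tsum
      ((Finset.range N).map ⟨_, hinj⟩) fun _ _ => by positivity
    rw [← ellTwo_norm_sq, Finset.sum_map] at hsum
    refine le_trans (le_of_eq ?_) hsum
    rw [Finset.sum_congr rfl (g := fun _ => ‖φ n₀‖ ^ 2)]
    · simp
    · intro k hk
      have hk := Finset.mem_range.1 hk
      have h1 : T ≤ (k + 1) * T := Nat.le_mul_of_pos_left T (by omega)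
      have h2 : (k + 1) * T + T ≤ (N + 1) * T := by
        rw [← Nat.succ_mul]
        exact Nat.mul_le_mul_right T (by omega)
      have h3 : q = (N + 1) * T + T := by rw [hq]; ring
      change ‖w (n₀ + (k + 1) * T)‖ ^ 2 = _
      rw [hwin _ (by omega) (by omega), hper']
  · set f := (periodicJacobi a b - z • ContinuousLinearMap.id ℂ EllTwo) ⟨w, hmem⟩
    have hf : ∀ n, f n = jacobiAction (periodicExt a) (periodicExt b) w n - z * w n :=
      periodicJacobi_sub_smul_apply a b z _
    have hprod : ∀ (d : Fin T → ℝ) (m n : ℕ), ‖(periodicExt d m : ℂ) * w n‖ ≤ ‖d‖ * B := by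
      intro d m n
      rw [norm_mul, Complex.norm_real]
      exact mul_le_mul (abs_periodicExt_le d m) (hwB n) (norm_nonneg _) (norm_nonneg _)
    have hfB : ∀ n, ‖f n‖ ≤ ‖a‖ * B + ‖b‖ * B + ‖a‖ * B + ‖z‖ * B := by
      intro n
      have hzw : ‖z * w n‖ ≤ ‖z‖ * B := by
        rw [norm_mul]
        exact mul_le_mul_of_nonneg_left (hwB n) (norm_nonneg _)
      rw [hf]
      refine (norm_sub_le _ _).trans (add_le_add ?_ hzw)
      rcases n with _ | n
      · have : 0 ≤ ‖a‖ * B := by positivity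
        have h := norm_add_le ((periodicExt b 0 : ℂ) * w 0) (periodicExt a 0 * w 1)
        have h1 := hprod b 0 0
        have h2 := hprod a 0 1
        simp only [jacobiAction]
        linarith
      · exact (norm_add_le _ _).trans (add_le_add ((norm_add_le _ _).trans
          (add_le_add (hprod _ _ _) (hprod _ _ _))) (hprod _ _ _))
    have hsupp : ∀ n ∉ ({T - 1, T, q - 1, q} : Finset ℕ), f n = 0 := by
      intro n hn
      simp only [Finset.mem_insert, Finset.mem_singleton, not_or] at hn
      rw [hf]
      rcases n with _ | n
      · simp only [jacobiAction]
        rw [hwout 0 (by omega), hwout 1 (by omega)]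
        simp
      · simp only [jacobiAction]
        by_cases h : T ≤ n ∧ n + 2 < q
        · have := hφ n
          simp only [Complex.real_smul, Complex.coe_algebraMap] at this
          rw [hwin n (by omega) (by omega), hwin (n + 1) (by omega) (by omega),
            hwin (n + 2) (by omega) (by omega)]
          linear_combination this
        · rw [hwout n (by omega), hwout (n + 1) (by omega), hwout (n + 2) (by omega)]
          simp
    refine (norm_le_of_support_subset hsupp hfB).trans ?_
    refine mul_le_mul_of_nonneg_right ?_ (by positivity)
    exact_mod_cast Finset.card_le_four

theorem not_isFredholm_periodicJacobi_sub_smul (ha : ∀ i, a i ≠ 0) {z : ℂ} {c : ℝ} (hc : |c| ≤ 2)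
    (hz : jacobiDiscr T (periodicExt a) (periodicExt b) z = c) :
    ¬ (periodicJacobi a b - z • ContinuousLinearMap.id ℂ EllTwo).IsFredholm := by
  intro hF
  obtain ⟨C, hC, hpre⟩ := hF.exists_preimage_norm_le
  obtain ⟨C', hC', hker⟩ := exists_ker_norm_le (b := b) ha z
  obtain ⟨δ, M, hδ, happrox⟩ := exists_approximate_eigenvectors ha hc hz
  set A := periodicJacobi a b - z • ContinuousLinearMap.id ℂ EllTwo
  obtain ⟨N, hN⟩ := exists_nat_gt ((C' * (C * M) + C * M) ^ 2 / δ)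
  obtain ⟨u, hu0, huN, hAu⟩ := happrox N
  obtain ⟨v, hv, hvn⟩ := hpre u
  have hvM : ‖v‖ ≤ C * M := hvn.trans (mul_le_mul_of_nonneg_left hAu hC)
  have hk := hker (u - v) (by rw [map_sub, hv, sub_self])
  -- As `u` vanishes at the first site, the first entry of `u - v` is controlled by `v`.
  have hk0 : ‖(u - v) 0‖ ≤ C * M := by
    rw [lp.coeFn_sub, Pi.sub_apply, hu0, zero_sub, norm_neg]
    exact (lp.norm_apply_le_norm (by norm_num) v 0).trans hvM
  have hu : ‖u‖ ≤ C' * (C * M) + C * M := by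
    have h := norm_add_le (u - v) v
    rw [sub_add_cancel] at h
    have := mul_le_mul_of_nonneg_left hk0 hC'
    linarith
  have hsq : ‖u‖ ^ 2 ≤ (C' * (C * M) + C * M) ^ 2 := pow_le_pow_left₀ (norm_nonneg _) hu 2
  rw [div_lt_iff₀ hδ] at hN
  linarith

/-- The essential spectrum consists of the points where the discriminant lies in `[-2, 2]`. -/
theorem essentialSpectrum_periodicJacobi (ha : ∀ i, a i ≠ 0) :
    essentialSpectrum (periodicJacobi a b)
      = {z | ∃ c : ℝ, |c| ≤ 2 ∧ jacobiDiscr T (periodicExt a) (periodicExt b) z = (c : ℂ)} := by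
  ext z
  simp only [essentialSpectrum, Set.mem_ofPred_eq]
  constructor
  · intro h
    by_contra hz
    exact h (isFredholm_periodicJacobi_sub_smul ha hz)
  · rintro ⟨c, hc, hz⟩
    exact not_isFredholm_periodicJacobi_sub_smul ha hc hz

end OnBands

/-! ### The exceptional parameters -/

section Generic

open Polynomial

/-- The values of the first off-diagonal entry for which some gap of a periodic Jacobi matrix with
period `m + 1` is closed, together with `0`. The entries of index `0` of `α` and `β` do not enter. -/
def exceptionalEntries (m : ℕ) (α β : ℕ → ℝ) : Set ℝ :=
  {t | t = 0 ∨ ∃ x : ℝ, jacobiSol α β x 0 1 (m + 1) = 0 ∧ (α m * jacobiSol α β x 0 1 m) ^ 2 = t ^ 2}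

theorem finite_exceptionalEntries {m : ℕ} {α : ℕ → ℝ} (β : ℕ → ℝ)
    (hα : ∀ i, 0 < i → i < m + 1 → 0 < α i) : (exceptionalEntries m α β).Finite := by
  obtain ⟨-, hlead, -⟩ := exists_interlacing_zeros_jacobiSol β hα (le_refl (m + 1))
  set S := jacobiSol α β (X : ℝ[X]) 0 1 (m + 1) with hS
  have hev : ∀ x : ℝ, S.eval x = jacobiSol α β x 0 1 (m + 1) := fun x => by
    have := map_jacobiSol (aeval x) α β (X : ℝ[X]) 0 1 (m + 1)
    simpa [coe_aeval_eq_eval] using this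
  have hZ : {x : ℝ | jacobiSol α β x 0 1 (m + 1) = 0}.Finite := by
    refine (Polynomial.finite_setOfPred_isRoot (leadingCoeff_ne_zero.1 hlead.ne')).subset fun x hx => ?_
    exact (hev x).trans hx
  refine ((Set.finite_singleton (0 : ℝ)).union (hZ.biUnion fun x _ =>
    Set.toFinite {α m * jacobiSol α β x 0 1 m, -(α m * jacobiSol α β x 0 1 m)})).subset ?_
  rintro t (rfl | ⟨x, hx, ht⟩)
  · exact Or.inl rfl
  · refine Or.inr (Set.mem_biUnion hx ?_)
    rcases sq_eq_sq_iff_eq_or_eq_neg.1 ht.symm with h | h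
    · exact Or.inl h
    · exact Or.inr h

theorem periodicExt_update_zero {T : ℕ} [NeZero T] (c : Fin T → ℝ) (t : ℝ) :
    periodicExt (Function.update c 0 t) 0 = t := by
  have : Fin.ofNat T 0 = 0 := by simp
  rw [periodicExt, this, Function.update_self]

theorem periodicExt_update_of_pos {T : ℕ} [NeZero T] (c : Fin T → ℝ) (t : ℝ) {n : ℕ} (h0 : 0 < n)
    (hn : n < T) : periodicExt (Function.update c 0 t) n = periodicExt c n := by
  have : Fin.ofNat T n ≠ 0 := by
    intro h
    have := congrArg Fin.val h
    simp [Fin.ofNat, Nat.mod_eq_of_lt hn] at this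
    omega
  rw [periodicExt, Function.update_of_ne this, periodicExt]

end Generic

theorem mainTheorem7 (T : ℕ) [NeZero T] (a b : Fin T → ℝ) (ha : ∀ i, 0 < a i) :
    ∃ D : Set (ℝ × ℝ), IsOpen D ∧ Dense D ∧
      ∀ ε η : ℝ, (ε, η) ∈ D →
        IsUnionOfDistinctIntervals T (essentialSpectrum (perturbedJacobi a b ε η)) := by
  obtain ⟨m, rfl⟩ := Nat.exists_eq_succ_of_ne_zero (NeZero.ne T)
  have hfin := finite_exceptionalEntries (m := m) (α := periodicExt a) (periodicExt b)
    fun i _ _ => ha _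
  set F := exceptionalEntries m (periodicExt a) (periodicExt b) with hF
  refine ⟨(fun p : ℝ × ℝ => a 0 + p.2) ⁻¹' Fᶜ, ?_, ?_, ?_⟩
  · exact hfin.isClosed.isOpen_compl.preimage (continuous_const.add continuous_snd)
  · exact hfin.countable.dense_compl ℝ |>.preimage
      ((Homeomorph.addLeft (a 0)).isOpenMap.comp isOpenMap_snd)
  · intro ε η hη
    have hη : a 0 + η ∉ F := hη
    rw [perturbedJacobi]
    set a' := Function.update a 0 (a 0 + η) with ha'
    set b' := Function.update b 0 (b 0 + ε) with hb'
    have h0 : a 0 + η ≠ 0 := fun h => hη (Or.inl h)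
    have hne : ∀ i, a' i ≠ 0 := by
      intro i
      by_cases hi : i = 0
      · rw [hi, ha', Function.update_self]
        exact h0
      · rw [ha', Function.update_of_ne hi]
        exact (ha i).ne'
    have hα : ∀ n, 0 < n → n < m + 1 → periodicExt a' n = periodicExt a n := fun n h1 h2 =>
      periodicExt_update_of_pos a _ h1 h2
    have hβ : ∀ n, 0 < n → n < m + 1 → periodicExt b' n = periodicExt b n := fun n h1 h2 =>
      periodicExt_update_of_pos b _ h1 h2
    have hα0 : periodicExt a' 0 = a 0 + η := periodicExt_update_zero a _
    rw [essentialSpectrum_periodicJacobi hne]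
    refine isUnionOfDistinctIntervals_jacobiDiscr (fun i h1 h2 => ?_) (fun i => hne _) ?_ ?_
    · rw [hα i h1 h2]
      exact ha _
    · have := periodicExt_add_period a' 0
      rwa [zero_add] at this
    · intro x hx hsq
      rw [jacobiSol_congr x 1 hα hβ le_rfl] at hx
      rw [jacobiSol_congr x 1 hα hβ (Nat.le_succ m), hα0] at hsq
      refine hη (Or.inr ⟨x, hx, ?_⟩)
      -- For period one, `u_1 = 1` has no zero, so that only `α m` with `0 < m` matters.
      rcases Nat.eq_zero_or_pos m with rfl | hm
      · simp [jacobiSol] at hx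
      · rwa [hα m hm (Nat.lt_succ_self m)] at hsq
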